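/- Let $H\in(\tfrac12,1)$ and $T\in(0,\infty)$, let $B^H=(B^H_t)_{t\in[0,T]}$ be a fractional Brownian motion with Hurst parameter $H$ (a centred Gaussian process with almost surely continuous paths and $\mathbb{E}[B^H_tB^H_s]=\tfrac12(t^{2H}+s^{2H}-|t-s|^{2H})$), and let $X=(X_t)_{t\in[0,T]}$ satisfy $$X_t=x_0+\int_0^t b(X_s)\,ds+\int_0^t\sigma(X_s)\,dB^H_s,\qquad t\in[0,T],$$ almost surely, where $x_0\in\mathbb{R}$, $b:\mathbb{R}\to\mathbb{R}$ is measurable, $\sigma:\mathbb{R}\to\mathbb{R}$ is globally Lipschitz continuous, and both integrals exist. Here and below, integrals with respect to $B^H$ are pathwise Riemann--Stieltjes integrals, that is, limits of Riemann--Stieltjes sums over all tagged partitions as the mesh tends to zero. Assume that almost surely the paths of $X$ are Hölder continuous on $[0,T]$ of every order strictly less than $H$, and that for every $t\in(0,T]$ the law of $X_t$ has a density $p_t$ such that $t\mapsto\sup_{x\in\mathbb{R}}p_t(x)$ belongs to $L^1([0,T])$. Let $f:\mathbb{R}\to\mathbb{R}$ be convex with right derivative $f'$, let $\rho_\varepsilon(z)=(2\pi\varepsilon)^{-1/2}e^{-z^2/(2\varepsilon)}$,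 and let $f_n(z)=\int_0^z f_n'(y)\,dy$ be the Gaussian mollifications of $f$, with $$f_n'(z)=\int_{\mathbb{R}}\rho_{1/n}(z-y)\,f'(y)\,dy,\qquad z\in\mathbb{R}.$$ Assume that, for some $N\ge 1$, this integral converges absolutely for all $n\ge N$ and all $z\in\mathbb{R}$. Then, almost surely, the integrals $\int_0^T f'(X_s)\sigma(X_s)\,dB^H_s$ and $\int_0^T f_n'(X_s)\sigma(X_s)\,dB^H_s$, $n\ge N$, exist, and $$\lim_{n\to\infty}\int_0^T f_n'(X_s)\sigma(X_s)\,dB^H_s=\int_0^T f'(X_s)\sigma(X_s)\,dB^H_s .$$ -/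

import Mathlib

open MeasureTheory ProbabilityTheory Set Filter Topology
open scoped ENNReal NNReal

noncomputable section

namespace FractionalTanaka

/-- `HasRSIntegral g h a b I`: the Riemann–Stieltjes integral `∫_a^b g dh` exists and equals `I`,
i.e. the sums `∑ g(ξ_i) (h(t_{i+1}) - h(t_i))` over tagged partitions
`a = t_0 ≤ ξ_0 ≤ t_1 ≤ ⋯ ≤ t_m = b` converge to `I` as the mesh tends to zero. -/
def HasRSIntegral (g h : ℝ → ℝ) (a b I : ℝ) : Prop :=
  ∀ ε > 0, ∃ δ > 0, ∀ (m : ℕ) (t ξ : ℕ → ℝ), t 0 = a → t m = b →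
    (∀ i < m, ξ i ∈ Icc (t i) (t (i + 1))) → (∀ i < m, t (i + 1) - t i < δ) →
    |∑ i ∈ Finset.range m, g (ξ i) * (h (t (i + 1)) - h (t i)) - I| < ε

/-- `B` is a fractional Brownian motion on `[0, T]` with Hurst parameter `H`: a centred Gaussian
process with covariance `(t^{2H} + s^{2H} - |t - s|^{2H}) / 2` and almost surely continuous paths. -/
structure IsFractionalBrownianMotion {Ω : Type*} [MeasurableSpace Ω] (P : Measure Ω)
    (H T : ℝ) (B : ℝ → Ω → ℝ) : Prop where
  gaussian : IsGaussianProcess (fun t : Icc (0 : ℝ) T => B t) P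
  mean_zero : ∀ t ∈ Icc (0 : ℝ) T, ∫ ω, B t ω ∂P = 0
  covariance : ∀ t ∈ Icc (0 : ℝ) T, ∀ s ∈ Icc (0 : ℝ) T,
    ∫ ω, B t ω * B s ω ∂P = (t ^ (2 * H) + s ^ (2 * H) - |t - s| ^ (2 * H)) / 2
  continuous_paths : ∀ᵐ ω ∂P, ContinuousOn (fun t => B t ω) (Icc 0 T)

/-- `X` solves `dX_t = b(X_t) dt + σ(X_t) dB_t` on `[0, T]` with `X_0 = x₀`; the integral with
respect to `B` is a pathwise Riemann–Stieltjes integral. -/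
structure IsSolution {Ω : Type*} [MeasurableSpace Ω] (P : Measure Ω) (T : ℝ) (b σ : ℝ → ℝ)
    (x₀ : ℝ) (B X : ℝ → Ω → ℝ) : Prop where
  aemeasurable : ∀ t ∈ Icc (0 : ℝ) T, AEMeasurable (X t) P
  equation : ∀ᵐ ω ∂P, ∀ t ∈ Icc (0 : ℝ) T,
    IntervalIntegrable (fun s => b (X s ω)) volume 0 t ∧
    ∃ J : ℝ, HasRSIntegral (fun s => σ (X s ω)) (fun s => B s ω) 0 t J ∧
      X t ω = x₀ + (∫ s in (0 : ℝ)..t, b (X s ω)) + J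

/-- Almost surely, the paths of `X` on `[0, T]` are Hölder continuous of every order `γ < H`. -/
def HasHolderPathsBelow {Ω : Type*} [MeasurableSpace Ω] (P : Measure Ω) (H T : ℝ)
    (X : ℝ → Ω → ℝ) : Prop :=
  ∀ᵐ ω ∂P, ∀ γ ∈ Ioo 0 H, ∃ C : ℝ, ∀ s ∈ Icc (0 : ℝ) T, ∀ t ∈ Icc (0 : ℝ) T,
    |X t ω - X s ω| ≤ C * |t - s| ^ γ

/-- For every `t ∈ (0, T]` the law of `X_t` has density `p_t`, and `t ↦ sup_x p_t(x)` belongs to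
`L¹([0, T])`. -/
structure HasIntegrableSupDensity {Ω : Type*} [MeasurableSpace Ω] (P : Measure Ω) (T : ℝ)
    (X : ℝ → Ω → ℝ) (p : ℝ → ℝ → ℝ≥0∞) : Prop where
  measurable : ∀ t ∈ Ioc (0 : ℝ) T, Measurable (p t)
  law : ∀ t ∈ Ioc (0 : ℝ) T, P.map (X t) = volume.withDensity (p t)
  aemeasurable_sup : AEMeasurable (fun t => ⨆ x, p t x) (volume.restrict (Icc 0 T))
  lintegral_sup : ∫⁻ t in Icc 0 T, (⨆ x, p t x) < ∞

/-- The right derivative of `f`. -/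
def rightDeriv (f : ℝ → ℝ) (x : ℝ) : ℝ := derivWithin f (Ioi x) x

/-- The Gaussian kernel `ρ_ε`, with variance `ε`. -/
def gaussKernel (ε z : ℝ) : ℝ := (Real.sqrt (2 * Real.pi * ε))⁻¹ * Real.exp (-z ^ 2 / (2 * ε))

/-- `f_n' = ρ_{1/n} * f'`, the derivative of the Gaussian mollification `f_n`. For `f = |·|` this is
`2 ∫_{-∞}^z ρ_{1/n}(y) dy - 1`. -/
def mollifiedDeriv (f : ℝ → ℝ) (n : ℕ) (z : ℝ) : ℝ :=
  ∫ y, gaussKernel (1 / (n : ℝ)) (z - y) * rightDeriv f y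

end FractionalTanaka

end

namespace FractionalTanaka

/-! The function `φ = f'` is monotone and may jump, so `φ(X)` has no Hölder regularity and Young's
theorem does not apply directly. The randomness of `X` repairs this.

In space: let `ν` be the Stieltjes measure of `φ`, localised, and `U(x) = ∫ |x - y|^{-κ} dν(y)` with
`κ < 1`. The oscillation of `φ` on an interval of length `ℓ` containing `x` is at most `ℓ^κ U(x)`.
The mollifications obey the same kind of bound with constants independent of `n`, because a Gaussian
gives an interval of length `ℓ` around `z` mass at most `2 (ℓ/|z|)^κ` whatever its variance, and the
far tails of `φ` contribute only a uniformly Lipschitz term (`Monotone.exists_oscBound`).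

In time: since `sup_x p_t(x)` is integrable, `E ∫ U(X_t) dt < ∞`, so `w(s,t) = ∫_s^t (1 + U(X_r))
dr` is almost surely a finite, continuous, additive control. Averaging the spatial bound over `r ∈
[s,t]` and using that `X` and `B` are `α`-Hölder, the product of the oscillations of the integrand
and of `B` on `[s,t]` is at most a constant times `w(s,t)^θ`, where `θ = α + ακ > 1`
(`OscBound.rsControl`).

Young's argument needs only this product bound. It gives existence of all the integrals and a rate
for Riemann sums that is uniform in `n`. The potential is finite at `X_r` for almost every `r`;
there `φ` is continuous and the mollifications converge. With tags placed at such times, limit and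
integral may be exchanged (`RSControl.tendsto_integral`). -/

/-! ### Young integration under a control of the product of oscillations. -/

/-- `a = t 0 ≤ ξ 0 ≤ t 1 ≤ ⋯ ≤ t m = b` is a tagged partition of mesh less than `δ`. -/
structure IsTaggedPartition (a b δ : ℝ) (m : ℕ) (t ξ : ℕ → ℝ) : Prop where
  left : t 0 = a
  right : t m = b
  tag : ∀ i < m, ξ i ∈ Icc (t i) (t (i + 1))
  mesh : ∀ i < m, t (i + 1) - t i < δ

/-- The Riemann–Stieltjes sum of `g` against `h`. -/
noncomputable def rsSum (g h : ℝ → ℝ) (m : ℕ) (t ξ : ℕ → ℝ) : ℝ :=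
  ∑ i ∈ Finset.range m, g (ξ i) * (h (t (i + 1)) - h (t i))

/-- The product of the oscillations of `g` and `h` on an interval is dominated by the power `θ` of
the increment of `F`. -/
def RSControl (g h F : ℝ → ℝ) (θ a b : ℝ) : Prop :=
  ∀ s t x y u v, a ≤ s → t ≤ b → x ∈ Icc s t → y ∈ Icc s t → u ∈ Icc s t → v ∈ Icc s t →
    |g x - g y| * |h v - h u| ≤ (F t - F s) ^ θ

/-- The constant in Young's maximal inequality. -/
noncomputable def youngConst (θ : ℝ) : ℝ := 2 / (1 - 2 ^ (1 - θ))

theorem hasRSIntegral_iff {g h : ℝ → ℝ} {a b I : ℝ} :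
    HasRSIntegral g h a b I ↔ ∀ ε > 0, ∃ δ > 0, ∀ m t ξ, IsTaggedPartition a b δ m t ξ →
      |rsSum g h m t ξ - I| < ε := by
  constructor
  · intro H ε hε
    obtain ⟨δ, hδ, h1⟩ := H ε hε
    exact ⟨δ, hδ, fun m t ξ hp => h1 m t ξ hp.left hp.right hp.tag hp.mesh⟩
  · intro H ε hε
    obtain ⟨δ, hδ, h1⟩ := H ε hε
    exact ⟨δ, hδ, fun m t ξ h2 h3 h4 h5 => h1 m t ξ ⟨h2, h3, h4, h5⟩⟩

theorem two_rpow_one_sub_lt_one {θ : ℝ} (hθ : 1 < θ) : (2 : ℝ) ^ (1 - θ) < 1 :=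
  Real.rpow_lt_one_of_one_lt_of_neg (by norm_num) (by linarith)

theorem youngConst_pos {θ : ℝ} (hθ : 1 < θ) : 0 < youngConst θ :=
  div_pos two_pos (by linarith [two_rpow_one_sub_lt_one hθ])

/-- `youngConst θ` is the fixed point of the halving recursion in the maximal inequality: two halves
plus two boundary terms. -/
theorem youngConst_step {θ W : ℝ} (hθ : 1 < θ) (hW : 0 ≤ W) :
    2 * (youngConst θ * (W / 2) ^ θ) + 2 * W ^ θ = youngConst θ * W ^ θ := by
  have h1 : (2 : ℝ) ^ (1 - θ) = 2 / 2 ^ θ := by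
    rw [Real.rpow_sub two_pos, Real.rpow_one]
  have h2 : 0 < 1 - (2 : ℝ) ^ (1 - θ) := by linarith [two_rpow_one_sub_lt_one hθ]
  have h3 : youngConst θ * (1 - 2 ^ (1 - θ)) = 2 := by
    unfold youngConst; field_simp
  have h4 : 2 * (youngConst θ * (W / 2) ^ θ) = youngConst θ * W ^ θ * 2 ^ (1 - θ) := by
    rw [Real.div_rpow hW (by norm_num), h1]; ring
  rw [h4]
  linear_combination (-W ^ θ) * h3

/-- Take `k + 1` as the first index at which half of the increment has been covered; the single step
from `k` to `k + 1` may carry arbitrarily much. -/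
theorem exists_balanced_split {u : ℕ → ℝ} (hu : Monotone u) {i j : ℕ} (hij : i < j) :
    ∃ k, i ≤ k ∧ k < j ∧ u k - u i ≤ (u j - u i) / 2 ∧ u j - u (k + 1) ≤ (u j - u i) / 2 := by
  classical
  have hij' : u i ≤ u j := hu hij.le
  have hex : ∃ k, i ≤ k ∧ (u j - u i) / 2 ≤ u (k + 1) - u i :=
    ⟨j - 1, by omega, by rw [Nat.sub_add_cancel (by omega)]; linarith⟩
  obtain ⟨h1, h2⟩ := Nat.find_spec hex
  set k := Nat.find hex with hk
  have hkj : k ≤ j - 1 := Nat.find_min' hex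
    ⟨by omega, by rw [Nat.sub_add_cancel (by omega)]; linarith⟩
  refine ⟨k, h1, by omega, ?_, by linarith⟩
  rcases h1.eq_or_lt with h | h
  · rw [← h]; linarith
  · have := Nat.find_min hex (m := k - 1) (by omega)
    rw [Nat.sub_add_cancel (by omega)] at this
    by_contra! hc
    exact this ⟨by omega, hc.le⟩

variable {g h F : ℝ → ℝ} {θ a b : ℝ}

/-- Induction on a bound for the number of steps, bisecting at a balanced index. Each block carries
at most half of the control; regrouping around the middle step costs two products of oscillations,
each at most `W ^ θ`. The bound does not depend on the number of points. -/
theorem RSControl.maximal_inequality (hθ : 1 < θ) (hc : RSControl g h F θ a b)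
    (hF : MonotoneOn F (Icc a b)) {t : ℕ → ℝ} (ht : Monotone t) (hta : ∀ i, t i ∈ Icc a b) :
    ∀ n i j, j - i ≤ n → i ≤ j →
      |∑ k ∈ Finset.Ico i j, g (t k) * (h (t (k + 1)) - h (t k)) - g (t i) * (h (t j) - h (t i))|
        ≤ youngConst θ * (F (t j) - F (t i)) ^ θ := by
  have hu : Monotone (fun i => F (t i)) := fun i j hij => hF (hta i) (hta j) (ht hij)
  have hK := (youngConst_pos hθ).le
  intro n
  induction n with
  | zero =>
    intro i j h1 h2
    obtain rfl : i = j := by omega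
    simp [Real.zero_rpow (by linarith : θ ≠ 0)]
  | succ n ih =>
    intro i j h1 h2
    rcases h2.eq_or_lt with rfl | hij
    · simp [Real.zero_rpow (by linarith : θ ≠ 0)]
    obtain ⟨k, hik, hkj, hk1, hk2⟩ := exists_balanced_split hu hij
    have e1 := ih i k (by omega) hik
    have e2 := ih (k + 1) j (by omega) hkj
    have hW : 0 ≤ F (t j) - F (t i) := sub_nonneg.2 (hu hij.le)
    have b1 : (F (t k) - F (t i)) ^ θ ≤ ((F (t j) - F (t i)) / 2) ^ θ :=
      Real.rpow_le_rpow (sub_nonneg.2 (hu hik)) hk1 (by linarith)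
    have b2 : (F (t j) - F (t (k + 1))) ^ θ ≤ ((F (t j) - F (t i)) / 2) ^ θ :=
      Real.rpow_le_rpow (sub_nonneg.2 (hu hkj)) hk2 (by linarith)
    have mem : ∀ q, i ≤ q → q ≤ j → t q ∈ Icc (t i) (t j) := fun q h1 h2 => ⟨ht h1, ht h2⟩
    have c1 := hc (t i) (t j) (t k) (t i) (t k) (t (k + 1)) (hta i).1 (hta j).2
      (mem k hik hkj.le) (mem i le_rfl hij.le) (mem k hik hkj.le) (mem (k + 1) (by omega) hkj)
    have c2 := hc (t i) (t j) (t (k + 1)) (t i) (t (k + 1)) (t j) (hta i).1 (hta j).2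
      (mem (k + 1) (by omega) hkj) (mem i le_rfl hij.le) (mem (k + 1) (by omega) hkj)
      (mem j hij.le le_rfl)
    rw [← abs_mul] at c1 c2
    have hs : ∑ q ∈ Finset.Ico i j, g (t q) * (h (t (q + 1)) - h (t q))
        = ∑ q ∈ Finset.Ico i k, g (t q) * (h (t (q + 1)) - h (t q))
          + g (t k) * (h (t (k + 1)) - h (t k))
          + ∑ q ∈ Finset.Ico (k + 1) j, g (t q) * (h (t (q + 1)) - h (t q)) := by
      rw [← Finset.sum_Ico_consecutive _ hik hkj.le, Finset.sum_eq_sum_Ico_succ_bot hkj]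
      ring
    rw [hs, ← youngConst_step hθ hW]
    have key : ∑ q ∈ Finset.Ico i k, g (t q) * (h (t (q + 1)) - h (t q))
          + g (t k) * (h (t (k + 1)) - h (t k))
          + ∑ q ∈ Finset.Ico (k + 1) j, g (t q) * (h (t (q + 1)) - h (t q))
          - g (t i) * (h (t j) - h (t i))
        = (∑ q ∈ Finset.Ico i k, g (t q) * (h (t (q + 1)) - h (t q))
            - g (t i) * (h (t k) - h (t i)))
          + (∑ q ∈ Finset.Ico (k + 1) j, g (t q) * (h (t (q + 1)) - h (t q))
            - g (t (k + 1)) * (h (t j) - h (t (k + 1))))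
          + (g (t k) - g (t i)) * (h (t (k + 1)) - h (t k))
          + (g (t (k + 1)) - g (t i)) * (h (t j) - h (t (k + 1))) := by ring
    rw [key]
    refine (abs_add_le _ _).trans ?_
    refine (add_le_add_left ((abs_add_le _ _).trans (add_le_add_left (abs_add_le _ _) _)) _).trans ?_
    have d1 := e1.trans (mul_le_mul_of_nonneg_left b1 hK)
    have d2 := e2.trans (mul_le_mul_of_nonneg_left b2 hK)
    linarith

/-- Projection of the real line onto `[c, d]`. -/
def clampTo (c d x : ℝ) : ℝ := max c (min d x)

theorem clampTo_monotone (c d : ℝ) : Monotone (clampTo c d) := fun _ _ hxy =>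
  max_le_max le_rfl (min_le_min le_rfl hxy)

theorem clampTo_mem {c d : ℝ} (hcd : c ≤ d) (x : ℝ) : clampTo c d x ∈ Icc c d :=
  ⟨le_max_left _ _, max_le hcd (min_le_left _ _)⟩

theorem clampTo_of_le {c d x : ℝ} (h : x ≤ c) : clampTo c d x = c :=
  max_eq_left ((min_le_right _ _).trans h)

theorem clampTo_of_ge {c d x : ℝ} (hcd : c ≤ d) (h : d ≤ x) : clampTo c d x = d := by
  rw [clampTo, min_eq_left h, max_eq_right hcd]

theorem clampTo_of_mem {c d x : ℝ} (h : x ∈ Icc c d) : clampTo c d x = x := by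
  rw [clampTo, min_eq_right h.2, max_eq_right h.1]

/-- The part of `[c, d]` inside `[a, b]` is the part of `[a, b]` inside `[c, d]`, up to degenerate
intervals. -/
theorem clampTo_swap {Ξ : ℝ → ℝ → ℝ} (hΞ : ∀ x, Ξ x x = 0) {a b c d : ℝ} (hab : a ≤ b)
    (hcd : c ≤ d) :
    Ξ (clampTo a b c) (clampTo a b d) = Ξ (clampTo c d a) (clampTo c d b) := by
  rcases le_total d a with h1 | h1
  · rw [clampTo_of_le (h1), clampTo_of_le (hcd.trans h1), clampTo_of_ge hcd h1,
      clampTo_of_ge hcd (h1.trans hab), hΞ, hΞ]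
  rcases le_total b c with h2 | h2
  · rw [clampTo_of_ge hab h2, clampTo_of_ge hab (h2.trans hcd), clampTo_of_le h2,
      clampTo_of_le (hab.trans h2), hΞ, hΞ]
  · have e1 : clampTo a b c = clampTo c d a := by
      simp only [clampTo, min_eq_right h1, min_eq_right h2, max_comm]
    have e2 : clampTo a b d = clampTo c d b := by
      simp only [clampTo, min_comm d b]
      rw [max_eq_right (le_min hab h1), max_eq_right (le_min h2 hcd)]
    rw [e1, e2]

variable {δ : ℝ} {m : ℕ} {t ξ : ℕ → ℝ}

theorem IsTaggedPartition.step_le (hp : IsTaggedPartition a b δ m t ξ) {i : ℕ} (hi : i < m) :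
    t i ≤ t (i + 1) := (hp.tag i hi).1.trans (hp.tag i hi).2

theorem IsTaggedPartition.mono (hp : IsTaggedPartition a b δ m t ξ) :
    Monotone fun i => t (min i m) := by
  refine monotone_nat_of_le_succ fun i => ?_
  rcases lt_or_ge i m with h | h
  · rw [min_eq_left h.le, min_eq_left (by omega : i + 1 ≤ m)]
    exact hp.step_le h
  · rw [min_eq_right h, min_eq_right (by omega : m ≤ i + 1)]

theorem IsTaggedPartition.mem (hp : IsTaggedPartition a b δ m t ξ) (i : ℕ) :
    t (min i m) ∈ Icc a b := by
  constructor
  · simpa [hp.left] using hp.mono (Nat.zero_le i)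
  · simpa [hp.right] using hp.mono (le_max_left i m)

theorem IsTaggedPartition.mem_of_le (hp : IsTaggedPartition a b δ m t ξ) {i : ℕ} (hi : i ≤ m) :
    t i ∈ Icc a b := by
  simpa [min_eq_left hi] using hp.mem i

theorem IsTaggedPartition.le (hp : IsTaggedPartition a b δ m t ξ) : a ≤ b := by
  have := hp.mem 0
  exact this.1.trans this.2

theorem IsTaggedPartition.weaken (hp : IsTaggedPartition a b δ m t ξ) {δ' : ℝ} (hδ : δ ≤ δ') :
    IsTaggedPartition a b δ' m t ξ :=
  ⟨hp.left, hp.right, hp.tag, fun i hi => (hp.mesh i hi).trans_le hδ⟩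

/-- Left-point sums differ from their common refinement by at most the sum of the control. -/
theorem RSControl.leftSum_refine (hθ : 1 < θ) (hc : RSControl g h F θ a b)
    (hF : MonotoneOn F (Icc a b)) (hp : IsTaggedPartition a b δ m t ξ)
    {δ' : ℝ} {l : ℕ} {s η : ℕ → ℝ} (hq : IsTaggedPartition a b δ' l s η) :
    |rsSum g h m t t - ∑ i ∈ Finset.range m, ∑ k ∈ Finset.range l,
        g (clampTo (t i) (t (i + 1)) (s k)) * (h (clampTo (t i) (t (i + 1)) (s (k + 1)))
          - h (clampTo (t i) (t (i + 1)) (s k)))|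
      ≤ ∑ i ∈ Finset.range m, youngConst θ * (F (t (i + 1)) - F (t i)) ^ θ := by
  rw [rsSum, ← Finset.sum_sub_distrib]
  refine (Finset.abs_sum_le_sum_abs _ _).trans (Finset.sum_le_sum fun i hi => ?_)
  have hi := Finset.mem_range.1 hi
  have h1 := hp.step_le hi
  have hti := hp.mem_of_le hi.le
  have hti' := hp.mem_of_le (Nat.succ_le_of_lt hi)
  -- Freezing the index at `l` makes the sequence monotone on all of `ℕ`.
  have := hc.maximal_inequality hθ hF (t := fun k => clampTo (t i) (t (i + 1)) (s (min k l)))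
    (fun x y hxy => clampTo_monotone _ _ (hq.mono hxy))
    (fun k => Icc_subset_Icc hti.1 hti'.2 (clampTo_mem h1 _)) l 0 l (by omega) (by omega)
  simp only [Nat.zero_min, min_self, hq.left, hq.right] at this
  rw [clampTo_of_le hti.1, clampTo_of_ge h1 hti'.2, ← Finset.range_eq_Ico] at this
  rw [abs_sub_comm]
  refine le_of_eq_of_le (congrArg (fun x => |x - _|) (Finset.sum_congr rfl fun k hk => ?_)) this
  have hk := Finset.mem_range.1 hk
  rw [min_eq_left hk.le, min_eq_left (Nat.succ_le_of_lt hk)]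

theorem RSControl.rsSum_tag (hc : RSControl g h F θ a b)
    (hp : IsTaggedPartition a b δ m t ξ) :
    |rsSum g h m t ξ - rsSum g h m t t| ≤ ∑ i ∈ Finset.range m, (F (t (i + 1)) - F (t i)) ^ θ := by
  rw [rsSum, rsSum, ← Finset.sum_sub_distrib]
  refine (Finset.abs_sum_le_sum_abs _ _).trans (Finset.sum_le_sum fun i hi => ?_)
  have hi := Finset.mem_range.1 hi
  have h1 := hp.step_le hi
  rw [← sub_mul, abs_mul]
  exact hc _ _ _ _ _ _ (hp.mem_of_le hi.le).1 (hp.mem_of_le (Nat.succ_le_of_lt hi)).2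
    (hp.tag i hi) ⟨le_rfl, h1⟩ ⟨le_rfl, h1⟩ ⟨h1, le_rfl⟩

/-- The error of a Riemann–Stieltjes sum. -/
theorem RSControl.rsSum_sub (hθ : 1 < θ) (hc : RSControl g h F θ a b)
    (hF : MonotoneOn F (Icc a b)) (hp : IsTaggedPartition a b δ m t ξ)
    {δ' : ℝ} {l : ℕ} {s η : ℕ → ℝ} (hq : IsTaggedPartition a b δ' l s η) :
    |rsSum g h m t ξ - rsSum g h l s η| ≤
      (youngConst θ + 1) * (∑ i ∈ Finset.range m, (F (t (i + 1)) - F (t i)) ^ θ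
        + ∑ k ∈ Finset.range l, (F (s (k + 1)) - F (s k)) ^ θ) := by
  have h1 := hc.rsSum_tag hp
  have h2 := hc.rsSum_tag hq
  have h3 := hc.leftSum_refine hθ hF hp hq
  have h4 := hc.leftSum_refine hθ hF hq hp
  -- Both refined sums run over the intersections of a cell of one partition with a cell of the
  -- other; degenerate intersections contribute zero.
  have e : (∑ i ∈ Finset.range m, ∑ k ∈ Finset.range l,
        g (clampTo (t i) (t (i + 1)) (s k)) * (h (clampTo (t i) (t (i + 1)) (s (k + 1)))
          - h (clampTo (t i) (t (i + 1)) (s k))))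
      = ∑ k ∈ Finset.range l, ∑ i ∈ Finset.range m,
        g (clampTo (s k) (s (k + 1)) (t i)) * (h (clampTo (s k) (s (k + 1)) (t (i + 1)))
          - h (clampTo (s k) (s (k + 1)) (t i))) := by
    rw [Finset.sum_comm]
    refine Finset.sum_congr rfl fun k hk => ?_
    refine Finset.sum_congr rfl fun i hi => ?_
    exact clampTo_swap (Ξ := fun x y => g x * (h y - h x)) (by simp)
      (hp.step_le (Finset.mem_range.1 hi)) (hq.step_le (Finset.mem_range.1 hk))
  rw [e] at h3
  rw [← Finset.mul_sum] at h3 h4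
  rw [abs_le] at *
  constructor <;> linarith [h1.1, h1.2, h2.1, h2.2, h3.1, h3.2, h4.1, h4.2]

/-- Of each `w ^ θ`, the factor `w ^ (θ - 1)` is uniformly small by uniform continuity of `F`, and
the remaining factors `w` telescope. -/
theorem exists_mesh_sum_control_lt (hθ : 1 < θ) (hF : MonotoneOn F (Icc a b))
    (hFc : ContinuousOn F (Icc a b)) {ε : ℝ} (hε : 0 < ε) :
    ∃ δ > 0, ∀ m t ξ, IsTaggedPartition a b δ m t ξ →
      ∑ i ∈ Finset.range m, (F (t (i + 1)) - F (t i)) ^ θ < ε := by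
  by_cases hab : a ≤ b
  swap
  · exact ⟨1, one_pos, fun m t ξ hp => absurd hp.le hab⟩
  have hFab : F a ≤ F b := hF ⟨le_rfl, hab⟩ ⟨hab, le_rfl⟩ hab
  -- The summand 1 keeps `D` positive when `F` is constant and makes the final inequality strict.
  set D := F b - F a + 1 with hD
  have hDpos : 0 < D := by linarith
  set r := (ε / D) ^ (1 / (θ - 1)) with hr
  have hrpos : 0 < r := Real.rpow_pos_of_pos (div_pos hε hDpos) _
  have hrp : r ^ (θ - 1) = ε / D := by
    rw [hr, ← Real.rpow_mul (div_pos hε hDpos).le, one_div_mul_cancel (by linarith), Real.rpow_one]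
  have huc := isCompact_Icc.uniformContinuousOn_of_continuous hFc
  obtain ⟨δ, hδ, h1⟩ := Metric.uniformContinuousOn_iff.1 huc r hrpos
  refine ⟨δ, hδ, fun m t ξ hp => ?_⟩
  have hle : ∑ i ∈ Finset.range m, (F (t (i + 1)) - F (t i)) ^ θ
      ≤ ∑ i ∈ Finset.range m, (ε / D) * (F (t (i + 1)) - F (t i)) := by
    refine Finset.sum_le_sum fun i hi => ?_
    have hi := Finset.mem_range.1 hi
    have m1 := hp.mem_of_le hi.le
    have m2 := hp.mem_of_le (Nat.succ_le_of_lt hi)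
    have hst := hp.step_le hi
    have hw : 0 ≤ F (t (i + 1)) - F (t i) := sub_nonneg.2 (hF m1 m2 hst)
    have hlt : F (t (i + 1)) - F (t i) < r := by
      have := h1 _ m2 _ m1 (by
        rw [Real.dist_eq, abs_of_nonneg (by linarith)]; exact hp.mesh i hi)
      rw [Real.dist_eq, abs_of_nonneg hw] at this
      exact this
    have : (F (t (i + 1)) - F (t i)) ^ θ
        = (F (t (i + 1)) - F (t i)) ^ (θ - 1) * (F (t (i + 1)) - F (t i)) := by
      rcases hw.eq_or_lt with h0 | h0
      · rw [← h0, Real.zero_rpow (by linarith), mul_zero]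
      · rw [Real.rpow_sub_one h0.ne', div_mul_cancel₀ _ h0.ne']
    rw [this, ← hrp]
    exact mul_le_mul_of_nonneg_right (Real.rpow_le_rpow hw hlt.le (by linarith)) hw
  rw [← Finset.mul_sum, Finset.sum_range_sub (fun i => F (t i)), hp.left, hp.right] at hle
  refine hle.trans_lt ?_
  rw [div_mul_eq_mul_div, div_lt_iff₀ hDpos]
  exact mul_lt_mul_of_pos_left (by linarith) hε

/-- The set `S` allows tags to be restricted to times at which the integrands are known to converge.
-/
theorem exists_isTaggedPartition (hab : a < b) {δ : ℝ} (hδ : 0 < δ) {S : Set ℝ}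
    (hS : ∀ s t, a ≤ s → s < t → t ≤ b → ∃ x ∈ S, x ∈ Icc s t) :
    ∃ m t ξ, IsTaggedPartition a b δ m t ξ ∧ ∀ i < m, ξ i ∈ S := by
  obtain ⟨n, hn⟩ := exists_nat_gt ((b - a) / δ)
  have hn0 : 0 < (n : ℝ) := (div_pos (by linarith) hδ).trans hn
  have hn0' : 0 < n := by exact_mod_cast hn0
  set t : ℕ → ℝ := fun i => a + (b - a) * (i / n) with ht
  have hstep : ∀ i, t (i + 1) - t i = (b - a) / n := by
    intro i; simp only [ht]; push_cast; field_simp; ring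
  have hstep0 : 0 < (b - a) / n := div_pos (by linarith) hn0
  have hxi : ∀ i, ∃ x, i < n → x ∈ S ∧ x ∈ Icc (t i) (t (i + 1)) := by
    intro i
    by_cases hi : i < n
    · obtain ⟨x, hx1, hx2⟩ := hS (t i) (t (i + 1))
        (by simp only [ht]; have : 0 ≤ (b - a) * (i / n) := by
              have : 0 ≤ b - a := by linarith
              positivity
            linarith)
        (by linarith [hstep i])
        (by
          have h1 : ((i + 1 : ℕ) : ℝ) / n ≤ 1 := by
            rw [div_le_one hn0]; exact_mod_cast hi
          simp only [ht]
          nlinarith)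
      exact ⟨x, fun _ => ⟨hx1, hx2⟩⟩
    · exact ⟨0, fun h => absurd h hi⟩
  choose ξ hξ using hxi
  refine ⟨n, t, ξ, ⟨by simp [ht], by simp [ht, hn0.ne'], fun i hi => (hξ i hi).2, fun i _ => ?_⟩,
    fun i hi => (hξ i hi).1⟩
  rw [hstep, div_lt_iff₀ hn0]
  rw [div_lt_iff₀ hδ] at hn
  linarith

/-- Cauchy criterion for the Riemann–Stieltjes integral. -/
theorem exists_hasRSIntegral_of_cauchy (hab : a < b)
    (hC : ∀ ε > 0, ∃ δ > 0, ∀ m t ξ l s η, IsTaggedPartition a b δ m t ξ →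
      IsTaggedPartition a b δ l s η → |rsSum g h m t ξ - rsSum g h l s η| < ε) :
    ∃ I, HasRSIntegral g h a b I := by
  have hpart : ∀ n : ℕ, ∃ p : ℕ × (ℕ → ℝ) × (ℕ → ℝ),
      IsTaggedPartition a b (1 / ((n : ℝ) + 1)) p.1 p.2.1 p.2.2 := by
    intro n
    obtain ⟨m, t, ξ, h1, -⟩ := exists_isTaggedPartition hab (δ := 1 / ((n : ℝ) + 1))
      (by positivity) (S := univ) (fun s t _ hst _ => ⟨s, mem_univ _, le_rfl, hst.le⟩)
    exact ⟨(m, t, ξ), h1⟩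
  choose p hp using hpart
  have hfine : ∀ δ > 0, ∃ n0 : ℕ, ∀ n ≥ n0, IsTaggedPartition a b δ (p n).1 (p n).2.1 (p n).2.2 := by
    intro δ hδ
    obtain ⟨n0, hn0⟩ := exists_nat_one_div_lt hδ
    refine ⟨n0, fun n hn => (hp n).weaken (le_trans ?_ hn0.le)⟩
    exact one_div_le_one_div_of_le (by positivity) (by exact_mod_cast Nat.succ_le_succ hn)
  have hcs : CauchySeq fun n => rsSum g h (p n).1 (p n).2.1 (p n).2.2 := by
    rw [Metric.cauchySeq_iff]
    intro ε hε
    obtain ⟨δ, hδ, h1⟩ := hC ε hε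
    obtain ⟨n0, hn0⟩ := hfine δ hδ
    exact ⟨n0, fun k hk l hl => h1 _ _ _ _ _ _ (hn0 k hk) (hn0 l hl)⟩
  obtain ⟨I, hI⟩ := cauchySeq_tendsto_of_complete hcs
  refine ⟨I, hasRSIntegral_iff.2 fun ε hε => ?_⟩
  obtain ⟨δ, hδ, h1⟩ := hC (ε / 2) (half_pos hε)
  refine ⟨δ, hδ, fun m t ξ hm => ?_⟩
  obtain ⟨n0, hn0⟩ := hfine δ hδ
  have : |rsSum g h m t ξ - I| ≤ ε / 2 := by
    refine le_of_tendsto ((tendsto_const_nhds.sub hI).abs) ?_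
    filter_upwards [eventually_ge_atTop n0] with n hn
    exact (h1 _ _ _ _ _ _ hm (hn0 n hn)).le
  linarith

/-- The mesh `δ` is chosen before `g` and `h`: it depends only on the control, which is what makes
the limit exchange possible. -/
theorem RSControl.cauchy (hθ : 1 < θ) (hF : MonotoneOn F (Icc a b))
    (hFc : ContinuousOn F (Icc a b)) {ε : ℝ} (hε : 0 < ε) :
    ∃ δ > 0, ∀ g h, RSControl g h F θ a b → ∀ m t ξ l s η, IsTaggedPartition a b δ m t ξ →
      IsTaggedPartition a b δ l s η → |rsSum g h m t ξ - rsSum g h l s η| < ε := by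
  have hK := youngConst_pos hθ
  obtain ⟨δ, hδ, h1⟩ := exists_mesh_sum_control_lt hθ hF hFc
    (ε := ε / (2 * (youngConst θ + 1))) (by positivity)
  refine ⟨δ, hδ, fun g h hc m t ξ l s η hp hq => (hc.rsSum_sub hθ hF hp hq).trans_lt ?_⟩
  have e : (youngConst θ + 1) * (ε / (2 * (youngConst θ + 1)) + ε / (2 * (youngConst θ + 1))) = ε := by
    field_simp; ring
  calc _ < (youngConst θ + 1) * (ε / (2 * (youngConst θ + 1)) + ε / (2 * (youngConst θ + 1))) :=
        mul_lt_mul_of_pos_left (add_lt_add (h1 _ _ _ hp) (h1 _ _ _ hq)) (by linarith)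
    _ = ε := e

theorem RSControl.exists_hasRSIntegral (hθ : 1 < θ) (hab : a < b) (hc : RSControl g h F θ a b)
    (hF : MonotoneOn F (Icc a b)) (hFc : ContinuousOn F (Icc a b)) :
    ∃ I, HasRSIntegral g h a b I := by
  refine exists_hasRSIntegral_of_cauchy hab fun ε hε => ?_
  obtain ⟨δ, hδ, h1⟩ := RSControl.cauchy hθ hF hFc hε
  exact ⟨δ, hδ, h1 g h hc⟩

/-- Riemann–Stieltjes integrals with a common control converge if the integrands converge on a dense
set of times. -/
theorem RSControl.tendsto_integral (hθ : 1 < θ) (hab : a < b)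
    (hF : MonotoneOn F (Icc a b)) (hFc : ContinuousOn F (Icc a b))
    {gs : ℕ → ℝ → ℝ} {N : ℕ} (hcs : ∀ n ≥ N, RSControl (gs n) h F θ a b)
    (hc : RSControl g h F θ a b) {S : Set ℝ}
    (hS : ∀ s t, a ≤ s → s < t → t ≤ b → ∃ x ∈ S, x ∈ Icc s t)
    (hlim : ∀ x ∈ S, Tendsto (fun n => gs n x) atTop (𝓝 (g x)))
    {J : ℕ → ℝ} {I : ℝ} (hJ : ∀ n ≥ N, HasRSIntegral (gs n) h a b (J n))
    (hI : HasRSIntegral g h a b I) : Tendsto J atTop (𝓝 I) := by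
  -- A rate of approximation of the integral by its sums, common to all integrands with this
  -- control.
  have key : ∀ ε > 0, ∃ δ > 0, ∀ g, RSControl g h F θ a b → ∀ I, HasRSIntegral g h a b I →
      ∀ m t ξ, IsTaggedPartition a b δ m t ξ → |rsSum g h m t ξ - I| < ε := by
    intro ε hε
    obtain ⟨δ, hδ, h1⟩ := RSControl.cauchy (a := a) (b := b) hθ hF hFc (half_pos hε)
    refine ⟨δ, hδ, fun g hg I hI m t ξ hp => ?_⟩
    obtain ⟨δ', hδ', h2⟩ := hasRSIntegral_iff.1 hI (ε / 2) (half_pos hε)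
    obtain ⟨l, s, η, hq, -⟩ := exists_isTaggedPartition hab (lt_min hδ hδ') (S := univ)
      (fun s t _ hst _ => ⟨s, mem_univ _, le_rfl, hst.le⟩)
    have h3 := h1 g h hg _ _ _ _ _ _ hp (hq.weaken (min_le_left _ _))
    have h4 := h2 _ _ _ (hq.weaken (min_le_right _ _))
    calc |rsSum g h m t ξ - I|
        ≤ |rsSum g h m t ξ - rsSum g h l s η| + |rsSum g h l s η - I| := abs_sub_le _ _ _
      _ < ε := by linarith
  rw [Metric.tendsto_atTop]
  intro ε hε
  obtain ⟨δ, hδ, h1⟩ := key (ε / 3) (by linarith)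
  obtain ⟨m, t, ξ, hp, hξ⟩ := exists_isTaggedPartition hab hδ hS
  have hconv : Tendsto (fun n => rsSum (gs n) h m t ξ) atTop (𝓝 (rsSum g h m t ξ)) :=
    tendsto_finsetSum _ fun i hi => (hlim _ (hξ i (Finset.mem_range.1 hi))).mul_const _
  obtain ⟨n0, hn0⟩ := Metric.tendsto_atTop.1 hconv (ε / 3) (by linarith)
  refine ⟨max n0 N, fun n hn => ?_⟩
  have a1 := h1 _ (hcs n ((le_max_right _ _).trans hn)) _ (hJ n ((le_max_right _ _).trans hn)) _ _ _ hp
  have a2 := h1 _ hc _ hI _ _ _ hp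
  have a3 := hn0 n ((le_max_left _ _).trans hn)
  rw [Real.dist_eq] at *
  rw [abs_lt] at *
  constructor <;> linarith [a1.1, a1.2, a2.1, a2.2, a3.1, a3.2]

/-! ### Chaining: from dyadic increments to Hölder continuity. -/

section Chaining

variable {h : ℝ → ℝ} {K q : ℝ}

/-- The largest dyadic point of order `n` below `s`. -/
noncomputable def dyadicFloor (n : ℕ) (s : ℝ) : ℝ := (⌊2 ^ n * s⌋₊ : ℝ) / 2 ^ n

theorem dyadicFloor_le {n : ℕ} {s : ℝ} (hs : 0 ≤ s) : dyadicFloor n s ≤ s := by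
  rw [dyadicFloor, div_le_iff₀ (by positivity), mul_comm]
  exact Nat.floor_le (by positivity)

theorem dyadicFloor_nonneg (n : ℕ) (s : ℝ) : 0 ≤ dyadicFloor n s := by
  unfold dyadicFloor; positivity

theorem lt_dyadicFloor_add (n : ℕ) (s : ℝ) : s < dyadicFloor n s + (1 / 2) ^ n := by
  have := Nat.lt_floor_add_one (2 ^ n * s)
  have h2 : (0 : ℝ) < 2 ^ n := by positivity
  rw [dyadicFloor, one_div_pow, ← add_div, lt_div_iff₀ h2]
  linarith

theorem tendsto_dyadicFloor {s : ℝ} (hs : 0 ≤ s) :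
    Tendsto (fun n => dyadicFloor n s) atTop (𝓝 s) := by
  have h1 : Tendsto (fun n : ℕ => s - (1 / 2 : ℝ) ^ n) atTop (𝓝 (s - 0)) :=
    tendsto_const_nhds.sub (tendsto_pow_atTop_nhds_zero_of_lt_one (by norm_num) (by norm_num))
  rw [sub_zero] at h1
  exact tendsto_of_tendsto_of_tendsto_of_le_of_le h1 tendsto_const_nhds
    (fun n => by linarith [lt_dyadicFloor_add n s]) (fun n => dyadicFloor_le hs)

theorem dyadic_increment_le (hK : 0 ≤ K) (hq : 0 ≤ q)
    (hd : ∀ n k : ℕ, k < 2 ^ n → |h ((k + 1 : ℕ) / 2 ^ n) - h (k / 2 ^ n)| ≤ K * q ^ n)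
    {n i j : ℕ} (hij : i ≤ j) (hji : j ≤ i + 1) (hj : j ≤ 2 ^ n) :
    |h (j / 2 ^ n) - h (i / 2 ^ n)| ≤ K * q ^ n := by
  rcases hij.eq_or_lt with rfl | hlt
  · simp; positivity
  · obtain rfl : j = i + 1 := by omega
    exact hd n i (by omega)

theorem floor_le_two_pow {n : ℕ} {s : ℝ} (hs : s ∈ Icc (0 : ℝ) 1) : ⌊2 ^ n * s⌋₊ ≤ 2 ^ n := by
  have : 2 ^ n * s ≤ ((2 ^ n : ℕ) : ℝ) := by
    push_cast
    have : (0 : ℝ) < 2 ^ n := by positivity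
    nlinarith [hs.2]
  exact (Nat.floor_mono this).trans_eq (Nat.floor_natCast _)

/-- Consecutive dyadic floors of `s` coincide or are neighbours at the finer level, so the
increments form a geometric series; continuity identifies its limit. -/
theorem dyadicFloor_dist_le (hK : 0 ≤ K) (hq0 : 0 ≤ q) (hq1 : q < 1)
    (hd : ∀ n k : ℕ, k < 2 ^ n → |h ((k + 1 : ℕ) / 2 ^ n) - h (k / 2 ^ n)| ≤ K * q ^ n)
    (hc : ContinuousOn h (Icc 0 1)) {s : ℝ} (hs : s ∈ Icc (0 : ℝ) 1) (n : ℕ) :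
    |h (dyadicFloor n s) - h s| ≤ K * q ^ n / (1 - q) := by
  have hmem : ∀ n, dyadicFloor n s ∈ Icc (0 : ℝ) 1 := fun n =>
    ⟨dyadicFloor_nonneg n s, (dyadicFloor_le hs.1).trans hs.2⟩
  have hlim : Tendsto (fun n => h (dyadicFloor n s)) atTop (𝓝 (h s)) :=
    (hc s hs).tendsto.comp (tendsto_nhdsWithin_iff.2
      ⟨tendsto_dyadicFloor hs.1, Eventually.of_forall hmem⟩)
  refine dist_le_of_le_geometric_of_tendsto q K hq1 (fun n => ?_) hlim n
  rw [dist_comm, Real.dist_eq]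
  have e : dyadicFloor n s = ((2 * ⌊2 ^ n * s⌋₊ : ℕ) : ℝ) / 2 ^ (n + 1) := by
    rw [dyadicFloor, pow_succ]; push_cast; field_simp
  have h0 : 0 ≤ 2 ^ n * s := mul_nonneg (by positivity) hs.1
  have e1 : 2 * ⌊2 ^ n * s⌋₊ ≤ ⌊2 ^ (n + 1) * s⌋₊ := by
    apply Nat.le_floor
    push_cast
    have := Nat.floor_le h0
    rw [pow_succ]; linarith
  have e2 : ⌊2 ^ (n + 1) * s⌋₊ ≤ 2 * ⌊2 ^ n * s⌋₊ + 1 := by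
    apply Nat.le_of_lt_succ
    rw [Nat.floor_lt (mul_nonneg (by positivity) hs.1)]
    push_cast
    have := Nat.lt_floor_add_one (2 ^ n * s)
    rw [pow_succ]; linarith
  rw [e]
  refine (dyadic_increment_le hK hq0 hd e1 e2 (floor_le_two_pow hs)).trans ?_
  exact mul_le_mul_of_nonneg_left (pow_le_pow_of_le_one hq0 hq1.le (Nat.le_succ n)) hK

/-- Hölder continuity on `[0, 1]` from dyadic increments. -/
theorem holder_of_dyadic_increments {α : ℝ} (hα : 0 < α) (hK : 0 ≤ K)
    (hd : ∀ n k : ℕ, k < 2 ^ n →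
      |h ((k + 1 : ℕ) / 2 ^ n) - h (k / 2 ^ n)| ≤ K * ((1 / 2 : ℝ) ^ α) ^ n)
    (hc : ContinuousOn h (Icc 0 1)) :
    ∃ C, ∀ s ∈ Icc (0 : ℝ) 1, ∀ t ∈ Icc (0 : ℝ) 1, |h t - h s| ≤ C * |t - s| ^ α := by
  set q : ℝ := (1 / 2 : ℝ) ^ α with hq
  have hq0 : 0 < q := Real.rpow_pos_of_pos (by norm_num) _
  have hq1 : q < 1 := Real.rpow_lt_one (by norm_num) (by norm_num) hα
  have hq1' : 0 < 1 - q := by linarith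
  set C := K * (1 + 2 / (1 - q)) / q with hC
  have main : ∀ s ∈ Icc (0 : ℝ) 1, ∀ t ∈ Icc (0 : ℝ) 1, s < t → |h t - h s| ≤ C * |t - s| ^ α := by
    intro s hs t ht hst
    -- With `2^{-(n+1)} < t - s ≤ 2^{-n}`, the level-`n` floors of `s` and `t` are equal or
    -- adjacent.
    obtain ⟨n, hn1, hn2⟩ := exists_nat_pow_near_of_lt_one (x := t - s) (y := (1 / 2 : ℝ))
      (by linarith) (by linarith [hs.1, ht.2]) (by norm_num) (by norm_num)
    have h2 : (0 : ℝ) < 2 ^ n := by positivity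
    have f1 : ⌊2 ^ n * s⌋₊ ≤ ⌊2 ^ n * t⌋₊ := Nat.floor_mono (by nlinarith)
    have f2 : ⌊2 ^ n * t⌋₊ ≤ ⌊2 ^ n * s⌋₊ + 1 := by
      apply Nat.le_of_lt_succ
      rw [Nat.floor_lt (mul_nonneg h2.le ht.1)]
      push_cast
      have := Nat.lt_floor_add_one (2 ^ n * s)
      rw [one_div_pow, le_div_iff₀ h2] at hn2
      linarith
    have g1 := dyadicFloor_dist_le hK hq0.le hq1 hd hc hs n
    have g2 := dyadicFloor_dist_le hK hq0.le hq1 hd hc ht n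
    have g3 : |h (dyadicFloor n t) - h (dyadicFloor n s)| ≤ K * q ^ n :=
      dyadic_increment_le hK hq0.le hd f1 f2 (floor_le_two_pow ht)
    have g4 : |h t - h s| ≤ K * (1 + 2 / (1 - q)) * q ^ n := by
      have e : K * (1 + 2 / (1 - q)) * q ^ n
          = K * q ^ n + K * q ^ n / (1 - q) + K * q ^ n / (1 - q) := by ring
      rw [e]
      rw [abs_le] at *
      constructor <;> linarith [g1.1, g1.2, g2.1, g2.2, g3.1, g3.2]
    have g5 : q ^ (n + 1) ≤ |t - s| ^ α := by
      rw [hq, ← Real.rpow_natCast, ← Real.rpow_mul (by norm_num), mul_comm,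
        Real.rpow_mul (by norm_num), Real.rpow_natCast, abs_of_pos (by linarith)]
      exact Real.rpow_le_rpow (by positivity) hn1.le hα.le
    refine g4.trans ?_
    have : K * (1 + 2 / (1 - q)) * q ^ n = C * q ^ (n + 1) := by
      rw [hC, pow_succ]; field_simp
    rw [this]
    exact mul_le_mul_of_nonneg_left g5 (by positivity)
  refine ⟨C, fun s hs t ht => ?_⟩
  rcases lt_trichotomy s t with hst | rfl | hst
  · exact main s hs t ht hst
  · simp [Real.zero_rpow hα.ne']
  · rw [abs_sub_comm, abs_sub_comm t]
    exact main t ht s hs hst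

theorem holder_of_dyadic_increments_Icc {α T : ℝ} (hT : 0 < T) (hα : 0 < α) (hK : 0 ≤ K)
    (hd : ∀ n k : ℕ, k < 2 ^ n →
      |h (T * ((k + 1 : ℕ) / 2 ^ n)) - h (T * (k / 2 ^ n))| ≤ K * ((1 / 2 : ℝ) ^ α) ^ n)
    (hc : ContinuousOn h (Icc 0 T)) :
    ∃ C, ∀ s ∈ Icc (0 : ℝ) T, ∀ t ∈ Icc (0 : ℝ) T, |h t - h s| ≤ C * |t - s| ^ α := by
  obtain ⟨C, hC⟩ := holder_of_dyadic_increments (h := fun x => h (T * x)) hα hK hd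
    (hc.comp (by fun_prop) (fun x hx => ⟨mul_nonneg hT.le hx.1, by
      have := mul_le_mul_of_nonneg_left hx.2 hT.le
      linarith⟩))
  refine ⟨C / T ^ α, fun s hs t ht => ?_⟩
  have h1 : ∀ x ∈ Icc (0 : ℝ) T, x / T ∈ Icc (0 : ℝ) 1 := fun x hx =>
    ⟨div_nonneg hx.1 hT.le, by rw [div_le_one hT]; exact hx.2⟩
  have := hC _ (h1 s hs) _ (h1 t ht)
  simp only [mul_div_cancel₀ _ hT.ne'] at this
  rw [← sub_div, abs_div, abs_of_pos hT, Real.div_rpow (abs_nonneg _) hT.le] at this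
  rw [div_mul_eq_mul_div, ← mul_div_assoc'] at *
  exact this

end Chaining

/-! ### Hölder paths of fractional Brownian motion by Gaussian moments. -/

section Gaussian

variable {Ω : Type*} [MeasurableSpace Ω] {P : Measure Ω} {H T : ℝ} {B : ℝ → Ω → ℝ}

/-- The variance follows by expanding the square and inserting the covariance. Writing it as a
square lets the increment be treated as `|t - s| ^ H` times a standard Gaussian. -/
theorem IsFractionalBrownianMotion.map_increment (hB : IsFractionalBrownianMotion P H T B)
    (hH : 0 < H) {s t : ℝ} (hs : s ∈ Icc 0 T) (ht : t ∈ Icc 0 T) :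
    P.map (fun ω => B t ω - B s ω) = gaussianReal 0 ((|t - s| ^ H) ^ 2).toNNReal := by
  have hP := hB.gaussian.isProbabilityMeasure
  have hg := hB.gaussian.hasGaussianLaw_fun_sub (s := ⟨t, ht⟩) (t := ⟨s, hs⟩)
  have ht2 := (hB.gaussian.hasGaussianLaw_eval ⟨t, ht⟩).memLp_two
  have hs2 := (hB.gaussian.hasGaussianLaw_eval ⟨s, hs⟩).memLp_two
  simp only at hg ht2 hs2
  have hmean : ∫ ω, (B t ω - B s ω) ∂P = 0 := by
    rw [integral_sub (ht2.integrable one_le_two) (hs2.integrable one_le_two),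
      hB.mean_zero t ht, hB.mean_zero s hs, sub_zero]
  have hsq : ∫ ω, (B t ω - B s ω) ^ 2 ∂P = (|t - s| ^ H) ^ 2 := by
    have e : ∀ ω, (B t ω - B s ω) ^ 2
        = B t ω * B t ω - 2 * (B t ω * B s ω) + B s ω * B s ω := fun ω => by ring
    simp_rw [e]
    have i1 : Integrable (fun ω => B t ω * B t ω) P := ht2.integrable_mul ht2
    have i2 : Integrable (fun ω => B t ω * B s ω) P := ht2.integrable_mul hs2
    have i3 : Integrable (fun ω => B s ω * B s ω) P := hs2.integrable_mul hs2
    have i4 : Integrable (fun ω => B t ω * B t ω - 2 * (B t ω * B s ω)) P :=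
      i1.sub (i2.const_mul 2)
    rw [integral_add i4 i3, integral_sub i1 (i2.const_mul 2),
      integral_const_mul, hB.covariance t ht t ht, hB.covariance t ht s hs,
      hB.covariance s hs s hs, sub_self, sub_self, abs_zero,
      Real.zero_rpow (by positivity : 2 * H ≠ 0), ← Real.rpow_natCast, ← Real.rpow_mul (abs_nonneg _)]
    push_cast
    rw [mul_comm H 2]
    ring
  have := hg.map_eq_gaussianReal
  rw [hmean, variance_of_integral_eq_zero hg.aemeasurable hmean, hsq] at this
  exact this

theorem lintegral_enorm_pow_gaussianReal (c : ℝ) (r : ℕ) :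
    ∫⁻ x, ‖x‖ₑ ^ r ∂(gaussianReal 0 (c ^ 2).toNNReal)
      = ‖c‖ₑ ^ r * ∫⁻ x, ‖x‖ₑ ^ r ∂(gaussianReal 0 1) := by
  have h1 := gaussianReal_map_const_mul (μ := 0) (v := 1) c
  rw [mul_zero, mul_one, ← Real.toNNReal_of_nonneg] at h1
  rw [← h1, lintegral_map (by fun_prop) (by fun_prop)]
  simp_rw [enorm_mul, mul_pow]
  rw [lintegral_const_mul _ (by fun_prop)]

theorem lintegral_enorm_pow_gaussianReal_ne_top (r : ℕ) :
    ∫⁻ x, ‖x‖ₑ ^ r ∂(gaussianReal 0 1) ≠ ∞ := by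
  rcases Nat.eq_zero_or_pos r with rfl | hr
  · simp
  have h1 := (memLp_id_gaussianReal (μ := 0) (v := 1) (r : ℝ≥0)).2
  have hr' : (r : ℝ≥0∞) ≠ 0 := by exact_mod_cast hr.ne'
  have := lintegral_rpow_enorm_lt_top_of_eLpNorm_lt_top (by simpa using hr') (by simp) h1
  simpa using this.ne

theorem IsFractionalBrownianMotion.lintegral_increment
    (hB : IsFractionalBrownianMotion P H T B)
    (hH : 0 < H) {s t : ℝ} (hs : s ∈ Icc 0 T) (ht : t ∈ Icc 0 T) (r : ℕ) :
    ∫⁻ ω, ‖B t ω - B s ω‖ₑ ^ r ∂P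
      = ‖|t - s| ^ H‖ₑ ^ r * ∫⁻ x, ‖x‖ₑ ^ r ∂(gaussianReal 0 1) := by
  have hm : AEMeasurable (fun ω => B t ω - B s ω) P :=
    (hB.gaussian.aemeasurable ⟨t, ht⟩).sub (hB.gaussian.aemeasurable ⟨s, hs⟩)
  rw [← lintegral_enorm_pow_gaussianReal, ← hB.map_increment hH hs ht,
    lintegral_map' (by fun_prop) hm]

/-- Fractional Brownian motion has Hölder continuous paths of every order less than `H`. -/
theorem IsFractionalBrownianMotion.ae_holder (hB : IsFractionalBrownianMotion P H T B)
    (hT : 0 < T) {α : ℝ} (hα : 0 < α) (hαH : α < H) :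
    ∀ᵐ ω ∂P, ∃ C, ∀ s ∈ Icc (0 : ℝ) T, ∀ t ∈ Icc (0 : ℝ) T, |B t ω - B s ω| ≤ C * |t - s| ^ α := by
  have hH : 0 < H := hα.trans hαH
  -- The `r`-th moments of the `2^n` rescaled increments at level `n` add up to order `2^{n(1 - r(H
  -- - α))}`, summable for this `r`.
  obtain ⟨r, hr⟩ := exists_nat_gt (1 / (H - α))
  have hHα : 0 < H - α := by linarith
  rw [div_lt_iff₀ hHα] at hr
  have hr0 : r ≠ 0 := by
    rintro rfl
    simp at hr
    linarith
  set M := ∫⁻ x, ‖x‖ₑ ^ r ∂(gaussianReal 0 1) with hM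
  have hMtop : M ≠ ∞ := lintegral_enorm_pow_gaussianReal_ne_top r
  have hpt : ∀ n k : ℕ, k ≤ 2 ^ n → T * ((k : ℝ) / 2 ^ n) ∈ Icc 0 T := by
    intro n k hk
    have h1 : (k : ℝ) / 2 ^ n ≤ 1 := by
      rw [div_le_one (by positivity)]; exact_mod_cast hk
    exact ⟨by positivity, by nlinarith⟩
  set D : ℕ → ℕ → Ω → ℝ := fun n k ω =>
    B (T * ((k + 1 : ℕ) / 2 ^ n)) ω - B (T * (k / 2 ^ n)) ω with hD
  have hDm : ∀ n k, k < 2 ^ n → AEMeasurable (D n k) P := fun n k hk =>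
    (hB.gaussian.aemeasurable ⟨_, hpt n (k + 1) hk⟩).sub
      (hB.gaussian.aemeasurable ⟨_, hpt n k hk.le⟩)
  set Z : ℕ → Ω → ℝ≥0∞ := fun n ω =>
    ∑ k ∈ Finset.range (2 ^ n), ‖((2 : ℝ) ^ α) ^ n * D n k ω‖ₑ ^ r with hZ
  have hZm : ∀ n, AEMeasurable (Z n) P := fun n =>
    Finset.aemeasurable_fun_sum _ fun k hk =>
      (((hDm n k (Finset.mem_range.1 hk)).const_mul _).enorm).pow_const r
  set ρ : ℝ := 2 * (((2 : ℝ) ^ α) ^ r * ((1 / 2 : ℝ) ^ H) ^ r) with hρ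
  have hρ0 : 0 ≤ ρ := by positivity
  have hρ1 : ρ < 1 := by
    have : ρ = (2 : ℝ) ^ (1 - r * (H - α)) := by
      rw [hρ, one_div, Real.inv_rpow two_pos.le, ← Real.rpow_neg two_pos.le, ← mul_pow,
        ← Real.rpow_add two_pos, ← Real.rpow_natCast, ← Real.rpow_mul two_pos.le,
        ← Real.rpow_one_add' two_pos.le]
      · congr 1; ring
      · have : 1 + (α + -H) * r ≠ 0 := by nlinarith
        exact this
    rw [this]
    exact Real.rpow_lt_one_of_one_lt_of_neg (by norm_num) (by linarith)
  have hZint : ∀ n, ∫⁻ ω, Z n ω ∂P = ENNReal.ofReal ((T ^ H) ^ r * ρ ^ n) * M := by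
    intro n
    rw [hZ]
    simp only
    rw [lintegral_finsetSum' _ fun k hk =>
      (((hDm n k (Finset.mem_range.1 hk)).const_mul _).enorm).pow_const r]
    have : ∀ k ∈ Finset.range (2 ^ n), ∫⁻ ω, ‖((2 : ℝ) ^ α) ^ n * D n k ω‖ₑ ^ r ∂P
        = ENNReal.ofReal (((((2 : ℝ) ^ α) ^ n) * (T ^ H * ((1 / 2 : ℝ) ^ H) ^ n)) ^ r) * M := by
      intro k hk
      have hk := Finset.mem_range.1 hk
      simp_rw [enorm_mul, mul_pow]
      rw [lintegral_const_mul'' _ ((hDm n k hk).enorm.pow_const r), hD,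
        hB.lintegral_increment hH (hpt n k hk.le) (hpt n (k + 1) hk), ← mul_assoc, ← hM]
      congr 1
      have e : |T * (((k + 1 : ℕ) : ℝ) / 2 ^ n) - T * ((k : ℝ) / 2 ^ n)| ^ H
          = T ^ H * ((1 / 2 : ℝ) ^ H) ^ n := by
        have e1 : T * (((k + 1 : ℕ) : ℝ) / 2 ^ n) - T * ((k : ℝ) / 2 ^ n) = T * (1 / 2) ^ n := by
          push_cast; rw [one_div_pow]; ring
        rw [e1, abs_of_pos (by positivity), Real.mul_rpow hT.le (by positivity), ← Real.rpow_natCast,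
          ← Real.rpow_mul (by norm_num), mul_comm (n : ℝ) H, Real.rpow_mul (by norm_num),
          Real.rpow_natCast]
      rw [e, ← mul_pow, ← enorm_mul, Real.enorm_eq_ofReal (by positivity),
        ← ENNReal.ofReal_pow (by positivity)]
      congr 1
      ring
    rw [Finset.sum_congr rfl this, Finset.sum_const, Finset.card_range, nsmul_eq_mul, ← mul_assoc]
    congr 1
    rw [← ENNReal.ofReal_natCast, ← ENNReal.ofReal_mul (by positivity)]
    congr 1
    push_cast
    rw [hρ]
    ring
  have hfin : ∫⁻ ω, ∑' n, Z n ω ∂P < ∞ := by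
    rw [lintegral_tsum hZm]
    simp_rw [hZint]
    rw [ENNReal.tsum_mul_right]
    refine ENNReal.mul_lt_top ?_ hMtop.lt_top
    rw [← ENNReal.ofReal_tsum_of_nonneg (fun n => by positivity)
      ((summable_geometric_of_lt_one hρ0 hρ1).mul_left _)]
    exact ENNReal.ofReal_lt_top
  filter_upwards [hB.continuous_paths,
    ae_lt_top' (AEMeasurable.tsum hZm) hfin.ne] with ω hc hω
  set S := (∑' n, Z n ω).toReal with hS
  -- Each rescaled increment, raised to the power `r`, is a single term of the finite sum `S`.
  refine holder_of_dyadic_increments_Icc (K := S ^ (1 / (r : ℝ))) hT hα (by positivity)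
    (fun n k hk => ?_) hc
  have h1 : ‖((2 : ℝ) ^ α) ^ n * D n k ω‖ₑ ^ r ≤ ∑' n, Z n ω :=
    (Finset.single_le_sum (f := fun k => ‖((2 : ℝ) ^ α) ^ n * D n k ω‖ₑ ^ r)
      (fun _ _ => zero_le) (Finset.mem_range.2 hk)).trans (ENNReal.le_tsum n)
  have h2 : |((2 : ℝ) ^ α) ^ n * D n k ω| ^ r ≤ S := by
    have := ENNReal.toReal_mono hω.ne h1
    simpa using this
  have h3 : |((2 : ℝ) ^ α) ^ n * D n k ω| ≤ S ^ (1 / (r : ℝ)) := by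
    have := Real.rpow_le_rpow (by positivity) h2 (by positivity : 0 ≤ 1 / (r : ℝ))
    rwa [one_div, Real.pow_rpow_inv_natCast (abs_nonneg _) hr0, ← one_div] at this
  rw [abs_mul, abs_of_pos (by positivity)] at h3
  rw [one_div (2 : ℝ), Real.inv_rpow two_pos.le, inv_pow, ← div_eq_mul_inv,
    le_div_iff₀ (by positivity), mul_comm]
  exact h3

end Gaussian

/-! ### Gaussian kernel estimates uniform in the variance. -/

section GaussKernel

variable {ε κ : ℝ}

theorem gaussKernel_eq (hε : 0 < ε) (z : ℝ) :
    gaussKernel ε z = gaussianPDFReal 0 ε.toNNReal z := by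
  simp [gaussKernel, gaussianPDFReal, Real.coe_toNNReal _ hε.le]

theorem gaussKernel_nonneg (ε z : ℝ) : 0 ≤ gaussKernel ε z := by
  unfold gaussKernel; positivity

theorem gaussKernel_neg (ε z : ℝ) : gaussKernel ε (-z) = gaussKernel ε z := by
  simp [gaussKernel]

theorem continuous_gaussKernel (ε : ℝ) : Continuous (gaussKernel ε) := by
  unfold gaussKernel; fun_prop

theorem integrable_gaussKernel (hε : 0 < ε) : Integrable (gaussKernel ε) := by
  rw [funext (gaussKernel_eq hε)]
  exact integrable_gaussianPDFReal _ _

theorem integral_gaussKernel (hε : 0 < ε) : ∫ z, gaussKernel ε z = 1 := by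
  simp_rw [gaussKernel_eq hε]
  exact integral_gaussianPDFReal_eq_one _ (by simpa using hε)

theorem lintegral_gaussKernel (hε : 0 < ε) : ∫⁻ z, ENNReal.ofReal (gaussKernel ε z) = 1 := by
  rw [← ofReal_integral_eq_lintegral_ofReal (integrable_gaussKernel hε)
    (Eventually.of_forall (gaussKernel_nonneg ε)), integral_gaussKernel hε, ENNReal.ofReal_one]

/-- From `1 + x ≤ exp x` and the arithmetic-geometric mean inequality; the bound is free of `ε`. -/
theorem abs_mul_gaussKernel_le (hε : 0 < ε) (z : ℝ) : |z| * gaussKernel ε z ≤ 1 := by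
  have hs : 0 < Real.sqrt ε := Real.sqrt_pos.2 hε
  have hss : Real.sqrt ε ^ 2 = ε := Real.sq_sqrt hε.le
  have h1 : Real.sqrt ε ≤ Real.sqrt (2 * Real.pi * ε) :=
    Real.sqrt_le_sqrt (by nlinarith [Real.pi_gt_three])
  have h2 : 1 + z ^ 2 / (2 * ε) ≤ Real.exp (z ^ 2 / (2 * ε)) := by
    linarith [Real.add_one_le_exp (z ^ 2 / (2 * ε))]
  have h3 : |z| ≤ Real.sqrt ε * (1 + z ^ 2 / (2 * ε)) := by
    have e : Real.sqrt ε * (1 + z ^ 2 / (2 * ε)) = (2 * ε + z ^ 2) / (2 * Real.sqrt ε) := by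
      field_simp
      rw [hss]
    rw [e, le_div_iff₀ (by positivity)]
    nlinarith [sq_nonneg (|z| - Real.sqrt ε), sq_abs z]
  have h4 : |z| ≤ Real.sqrt (2 * Real.pi * ε) * Real.exp (z ^ 2 / (2 * ε)) :=
    h3.trans (mul_le_mul h1 h2 (by positivity) (Real.sqrt_nonneg _))
  rw [gaussKernel, neg_div, Real.exp_neg, ← mul_inv, ← div_eq_mul_inv]
  exact div_le_one_of_le₀ h4 (by positivity)

/-- The Gaussian mass of an interval of length `h` around `z` is at most `2 (h / |z|) ^ κ`,
uniformly in the variance. -/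
theorem lintegral_gaussKernel_Icc_le (hε : 0 < ε) (hκ0 : 0 < κ) (hκ1 : κ < 1) {c d z : ℝ}
    (hcd : c < d) (hz : z ∈ Icc c d) :
    ∫⁻ u in Icc c d, ENNReal.ofReal (gaussKernel ε u)
      ≤ 2 * ENNReal.ofReal (d - c) ^ κ * ‖z‖ₑ ^ (-κ) := by
  have hh : 0 < d - c := sub_pos.2 hcd
  rcases eq_or_ne z 0 with rfl | hz0
  · rw [enorm_zero, ENNReal.zero_rpow_of_neg (by linarith), ENNReal.mul_top]
    · exact le_top
    · exact mul_ne_zero two_ne_zero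
        (ENNReal.rpow_pos (ENNReal.ofReal_pos.2 hh) ENNReal.ofReal_ne_top).ne'
  have hzp : 0 < |z| := abs_pos.2 hz0
  have e : 2 * ENNReal.ofReal (d - c) ^ κ * ‖z‖ₑ ^ (-κ)
      = ENNReal.ofReal (2 * ((d - c) / |z|) ^ κ) := by
    rw [← ofReal_norm, Real.norm_eq_abs, ENNReal.ofReal_rpow_of_pos hh,
      ENNReal.ofReal_rpow_of_pos hzp, ENNReal.ofReal_mul two_pos.le, ENNReal.ofReal_ofNat, mul_assoc,
      ← ENNReal.ofReal_mul (by positivity), Real.div_rpow hh.le hzp.le, Real.rpow_neg hzp.le,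
      div_eq_mul_inv]
  rw [e]
  -- A long interval is handled by total mass 1, since `2 (1/2)^κ ≥ 1`. On a short one `|u| ≥
  -- |z|/2`, so the density is at most `2/|z|`.
  rcases le_total (|z| / 2) (d - c) with h1 | h1
  · refine (setLIntegral_le_lintegral _ _).trans ?_
    rw [lintegral_gaussKernel hε, ← ENNReal.ofReal_one]
    apply ENNReal.ofReal_le_ofReal
    have h2 : (1 / 2 : ℝ) ≤ (d - c) / |z| := by
      rw [le_div_iff₀ hzp]; linarith
    have h3 : (1 / 2 : ℝ) ^ κ ≤ ((d - c) / |z|) ^ κ := Real.rpow_le_rpow (by norm_num) h2 hκ0.le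
    have h4 : (1 / 2 : ℝ) ^ (1 : ℝ) ≤ (1 / 2 : ℝ) ^ κ :=
      Real.rpow_le_rpow_of_exponent_ge (by norm_num) (by norm_num) hκ1.le
    rw [Real.rpow_one] at h4
    linarith
  · have h2 : ∀ u ∈ Icc c d, ENNReal.ofReal (gaussKernel ε u) ≤ ENNReal.ofReal (2 / |z|) := by
      intro u hu
      apply ENNReal.ofReal_le_ofReal
      have h3 : |z| / 2 ≤ |u| := by
        have h5 : |z - u| ≤ d - c := by
          rw [abs_le]; constructor <;> linarith [hz.1, hz.2, hu.1, hu.2]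
        linarith [abs_sub_abs_le_abs_sub z u]
      rw [le_div_iff₀ hzp]
      nlinarith [abs_mul_gaussKernel_le hε u, gaussKernel_nonneg ε u]
    refine (setLIntegral_mono measurable_const h2).trans ?_
    rw [setLIntegral_const, Real.volume_Icc, ← ENNReal.ofReal_mul (by positivity)]
    apply ENNReal.ofReal_le_ofReal
    have h3 : (d - c) / |z| ≤ 1 := by
      rw [div_le_one hzp]; linarith
    have h4 : ((d - c) / |z|) ^ (1 : ℝ) ≤ ((d - c) / |z|) ^ κ :=
      Real.rpow_le_rpow_of_exponent_ge (by positivity) h3 hκ1.le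
    rw [Real.rpow_one] at h4
    calc 2 / |z| * (d - c) = 2 * ((d - c) / |z|) := by ring
      _ ≤ _ := by linarith

theorem hasDerivAt_gaussKernel (hε : 0 < ε) (z : ℝ) :
    HasDerivAt (gaussKernel ε) (-(z / ε) * gaussKernel ε z) z := by
  unfold gaussKernel
  have h1 : HasDerivAt (fun z : ℝ => -z ^ 2 / (2 * ε)) (-(z / ε)) z := by
    refine (((hasDerivAt_pow 2 z).neg).div_const (2 * ε)).congr_deriv ?_
    have : ε ≠ 0 := hε.ne'
    push_cast
    field_simp
  refine ((h1.exp).const_mul (Real.sqrt (2 * Real.pi * ε))⁻¹).congr_deriv ?_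
  ring

/-- Away from the origin the derivatives of all narrower Gaussian kernels are dominated by one
kernel. -/
theorem abs_deriv_gaussKernel_le {n N : ℕ} (hN : 1 ≤ N) (hn : N ≤ n) {w : ℝ} (hw : 1 ≤ |w|) :
    |-(w / (1 / (n : ℝ))) * gaussKernel (1 / (n : ℝ)) w|
      ≤ 8 * gaussKernel (1 / (N : ℝ)) (|w| - 1) := by
  have hN' : (1 : ℝ) ≤ N := by exact_mod_cast hN
  have hn' : (N : ℝ) ≤ n := by exact_mod_cast hn
  have hn0 : (0 : ℝ) < n := by linarith
  have hN0 : (0 : ℝ) < N := by linarith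
  set p := Real.sqrt (2 * Real.pi) with hp
  have hp0 : 0 < p := Real.sqrt_pos.2 (by positivity)
  have form : ∀ m : ℝ, 0 < m → ∀ v, gaussKernel (1 / m) v
      = p⁻¹ * Real.sqrt m * Real.exp (-(m * v ^ 2 / 2)) := by
    intro m hm v
    rw [gaussKernel, mul_one_div, Real.sqrt_div (by positivity), inv_div, div_eq_inv_mul]
    congr 2
    field_simp
  rw [form n hn0, form N hN0, abs_mul, abs_neg, div_div_eq_mul_div, div_one, abs_mul,
    abs_of_pos hn0, abs_of_nonneg (by positivity : 0 ≤ p⁻¹ * Real.sqrt n * Real.exp _)]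
  set r := (n : ℝ) * |w| with hr
  have hsq : Real.sqrt n ≤ r := by
    have h1 : Real.sqrt n ≤ n := by
      rw [Real.sqrt_le_left hn0.le]; nlinarith
    nlinarith
  -- The 8 comes from `x²/2 ≤ exp x` at `x = r/2`. The factor `exp (r/2)` is then absorbed through
  -- `w² - |w| ≥ (|w| - 1)²` for `|w| ≥ 1`.
  have h8 : r ^ 2 ≤ 8 * Real.exp (r / 2) := by
    have := Real.quadratic_le_exp_of_nonneg (x := r / 2) (by positivity)
    nlinarith
  have h9 : Real.exp (r / 2) * Real.exp (-(n * w ^ 2 / 2)) ≤ Real.exp (-(N * (|w| - 1) ^ 2 / 2)) := by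
    rw [← Real.exp_add]
    apply Real.exp_le_exp.2
    have e1 : w ^ 2 = |w| ^ 2 := (sq_abs w).symm
    have e2 : (N : ℝ) * (|w| - 1) ^ 2 ≤ n * (|w| - 1) ^ 2 :=
      mul_le_mul_of_nonneg_right hn' (sq_nonneg _)
    have e3 : (n : ℝ) * (|w| - 1) ^ 2 ≤ n * (|w| ^ 2 - |w|) :=
      mul_le_mul_of_nonneg_left (by nlinarith) hn0.le
    rw [e1, hr]
    linarith
  have hsN : 1 ≤ Real.sqrt N := by rw [Real.one_le_sqrt]; exact hN'
  have hE := Real.exp_pos (-(n * w ^ 2 / 2))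
  calc |w| * n * (p⁻¹ * Real.sqrt n * Real.exp (-(n * w ^ 2 / 2)))
      = p⁻¹ * (r * Real.sqrt n) * Real.exp (-(n * w ^ 2 / 2)) := by rw [hr]; ring
    _ ≤ p⁻¹ * (8 * Real.exp (r / 2)) * Real.exp (-(n * w ^ 2 / 2)) := by
        have : r * Real.sqrt n ≤ 8 * Real.exp (r / 2) :=
          ((mul_le_mul_of_nonneg_left hsq (by positivity)).trans_eq (sq r).symm).trans h8
        exact mul_le_mul_of_nonneg_right
          (mul_le_mul_of_nonneg_left this (inv_nonneg.2 hp0.le)) hE.le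
    _ = p⁻¹ * 8 * (Real.exp (r / 2) * Real.exp (-(n * w ^ 2 / 2))) := by ring
    _ ≤ p⁻¹ * 8 * Real.exp (-(N * (|w| - 1) ^ 2 / 2)) := by gcongr
    _ ≤ p⁻¹ * 8 * Real.exp (-(N * (|w| - 1) ^ 2 / 2)) * Real.sqrt N :=
        le_mul_of_one_le_right (by positivity) hsN
    _ = _ := by ring

theorem gaussKernel_antitone_abs (hε : 0 < ε) {v w : ℝ} (h : |v| ≤ |w|) :
    gaussKernel ε w ≤ gaussKernel ε v := by
  unfold gaussKernel
  have : v ^ 2 ≤ w ^ 2 := sq_le_sq.2 h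
  gcongr

/-- Mean value inequality for `y` at distance at least 1 from `[-M, M]`. Two fixed kernels centred
at `±(M + 1)` dominate, and `φ` is integrable against both. -/
theorem abs_gaussKernel_sub_le {n N : ℕ} (hN : 1 ≤ N) (hn : N ≤ n) {M a b y : ℝ}
    (ha : -M ≤ a) (hab : a ≤ b) (hb : b ≤ M) (hy : M + 1 ≤ |y|) :
    |gaussKernel (1 / (n : ℝ)) (b - y) - gaussKernel (1 / (n : ℝ)) (a - y)|
      ≤ 8 * (gaussKernel (1 / (N : ℝ)) (M + 1 - y) + gaussKernel (1 / (N : ℝ)) (-(M + 1) - y))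
        * (b - a) := by
  have hN' : (1 : ℝ) ≤ N := by exact_mod_cast hN
  have hn' : (N : ℝ) ≤ n := by exact_mod_cast hn
  have hn0 : (0 : ℝ) < 1 / n := by
    have : (0 : ℝ) < n := by linarith
    positivity
  have hN0 : (0 : ℝ) < 1 / N := by positivity
  have h1 : ∀ w ∈ Icc (a - y) (b - y), ‖-(w / (1 / (n : ℝ))) * gaussKernel (1 / (n : ℝ)) w‖
      ≤ 8 * (gaussKernel (1 / (N : ℝ)) (M + 1 - y) + gaussKernel (1 / (N : ℝ)) (-(M + 1) - y)) := by
    intro w hw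
    have hwy : |y + w| ≤ M := by
      rw [abs_le]; constructor <;> linarith [hw.1, hw.2]
    have hw1 : |y| - M ≤ |w| := by
      have := abs_sub_abs_le_abs_sub y (-w)
      rw [abs_neg, sub_neg_eq_add] at this
      linarith
    rw [Real.norm_eq_abs]
    refine (abs_deriv_gaussKernel_le hN hn (by linarith)).trans ?_
    refine mul_le_mul_of_nonneg_left ?_ (by norm_num)
    have h2 : gaussKernel (1 / (N : ℝ)) (|w| - 1) ≤ gaussKernel (1 / (N : ℝ)) (|y| - (M + 1)) := by
      apply gaussKernel_antitone_abs hN0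
      rw [abs_of_nonneg (by linarith : 0 ≤ |y| - (M + 1)),
        abs_of_nonneg (by linarith : 0 ≤ |w| - 1)]
      linarith
    refine h2.trans ?_
    have p1 := gaussKernel_nonneg (1 / (N : ℝ)) (M + 1 - y)
    have p2 := gaussKernel_nonneg (1 / (N : ℝ)) (-(M + 1) - y)
    rcases abs_cases y with ⟨h3, -⟩ | ⟨h3, -⟩
    · rw [h3, ← gaussKernel_neg, neg_sub]; linarith
    · rw [h3]
      have : -y - (M + 1) = -(M + 1) - y := by ring
      rw [this]; linarith
  have := (convex_Icc (a - y) (b - y)).norm_image_sub_le_of_norm_hasDerivWithin_le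
    (fun w _ => (hasDerivAt_gaussKernel hn0 w).hasDerivWithinAt) h1
    (x := a - y) (y := b - y) ⟨le_rfl, by linarith⟩ ⟨by linarith, le_rfl⟩
  rw [Real.norm_eq_abs, Real.norm_eq_abs] at this
  have e : b - y - (a - y) = b - a := by ring
  rwa [e, abs_of_nonneg (by linarith : (0 : ℝ) ≤ b - a)] at this

theorem gaussKernel_rescale {n N : ℕ} (hN : 0 < N) (hn : 0 < n) (v : ℝ) :
    Real.sqrt (N / n) * gaussKernel (1 / (n : ℝ)) (Real.sqrt (N / n) * v)
      = gaussKernel (1 / (N : ℝ)) v := by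
  have hN' : (0 : ℝ) < N := by exact_mod_cast hN
  have hn' : (0 : ℝ) < n := by exact_mod_cast hn
  have hs : Real.sqrt (N / n) ^ 2 = N / n := Real.sq_sqrt (by positivity)
  have e : 2 * Real.pi * (1 / (n : ℝ)) = (2 * Real.pi * (1 / N)) * (N / n) := by field_simp
  unfold gaussKernel
  rw [mul_pow, hs, e, Real.sqrt_mul (by positivity)]
  have hs0 : Real.sqrt (N / n) ≠ 0 := (Real.sqrt_pos.2 (by positivity)).ne'
  rw [mul_inv, ← mul_assoc, mul_comm (Real.sqrt (2 * Real.pi * (1 / (N : ℝ))))⁻¹, ← mul_assoc,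
    mul_inv_cancel₀ hs0, one_mul]
  congr 2
  field_simp

end GaussKernel

/-! ### Oscillation of monotone functions bounded by Riesz potentials. -/

section Potential

variable {κ : ℝ} {ν : Measure ℝ} {φ : ℝ → ℝ}

/-- The Riesz potential `∫ |x - y|^{-κ} dν(y)`. -/
noncomputable def rieszPotential (κ : ℝ) (ν : Measure ℝ) (x : ℝ) : ℝ≥0∞ :=
  ∫⁻ y, ‖x - y‖ₑ ^ (-κ) ∂ν

theorem measurable_rieszPotential [SFinite ν] (κ : ℝ) : Measurable (rieszPotential κ ν) := by
  unfold rieszPotential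
  refine Measurable.lintegral_prod_right' (f := fun p : ℝ × ℝ => ‖p.1 - p.2‖ₑ ^ (-κ)) ?_
  fun_prop

/-- Without right continuity, `φ` still lies between its one-sided limits, and the closed interval
counts the atoms at both ends. -/
theorem Monotone.ofReal_sub_le_stieltjes (hφ : Monotone φ) (a b : ℝ) :
    ENNReal.ofReal (φ b - φ a) ≤ hφ.stieltjesFunction.measure (Icc a b) := by
  rw [StieltjesFunction.measure_Icc]
  apply ENNReal.ofReal_le_ofReal
  have h1 : φ b ≤ hφ.stieltjesFunction b := by
    rw [hφ.stieltjesFunction_eq]; exact hφ.le_rightLim le_rfl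
  have h2 : Function.leftLim hφ.stieltjesFunction a ≤ φ a := by
    refine le_of_tendsto (hφ.stieltjesFunction.mono.tendsto_leftLim a) ?_
    filter_upwards [self_mem_nhdsWithin] with x hx
    rw [hφ.stieltjesFunction_eq]
    exact hφ.rightLim_le hx
  linarith

theorem Monotone.exists_clamp_measure (hφ : Monotone φ) {R : ℝ} (hR : 0 ≤ R) :
    ∃ ν : Measure ℝ, IsFiniteMeasure ν ∧ ∀ a b, a ≤ b →
      ENNReal.ofReal (φ (clampTo (-R) R b) - φ (clampTo (-R) R a)) ≤ ν (Icc a b) := by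
  refine ⟨hφ.stieltjesFunction.measure.restrict (Icc (-R) R),
    isFiniteMeasure_restrict.2 isCompact_Icc.measure_lt_top.ne, fun a b hab => ?_⟩
  have hRR : -R ≤ R := by linarith
  rcases lt_or_ge b (-R) with h1 | h1
  · rw [clampTo_of_le h1.le, clampTo_of_le (hab.trans h1.le)]; simp
  rcases lt_or_ge R a with h2 | h2
  · rw [clampTo_of_ge hRR h2.le, clampTo_of_ge hRR (h2.le.trans hab)]; simp
  refine (Monotone.ofReal_sub_le_stieltjes hφ _ _).trans ?_
  rw [Measure.restrict_apply measurableSet_Icc]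
  apply measure_mono
  intro x hx
  refine ⟨⟨?_, ?_⟩, (clampTo_mem hRR a).1.trans hx.1, hx.2.trans (clampTo_mem hRR b).2⟩
  · refine le_trans ?_ hx.1
    rw [clampTo, min_eq_right h2]; exact le_max_right _ _
  · refine hx.2.trans ?_
    rw [clampTo]; exact max_le h1 (min_le_right _ _)

/-- For `y ∈ [a, b]` one has `1 ≤ (b - a)^κ |x - y|^{-κ}`; integrate over `[a, b]` against `ν`. -/
theorem ofReal_sub_le_rieszPotential (hκ : 0 < κ)
    (hν : ∀ a b, a ≤ b → ENNReal.ofReal (φ b - φ a) ≤ ν (Icc a b)) {a b x : ℝ} (hx : x ∈ Icc a b) :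
    ENNReal.ofReal (φ b - φ a) ≤ ENNReal.ofReal (b - a) ^ κ * rieszPotential κ ν x := by
  rcases (hx.1.trans hx.2).eq_or_lt with rfl | hab
  · simp
  refine (hν a b hab.le).trans ?_
  have hh : ENNReal.ofReal (b - a) ≠ 0 := by simpa using hab
  rw [rieszPotential, ← lintegral_const_mul _ (by fun_prop), ← setLIntegral_one]
  refine le_trans ?_ (setLIntegral_le_lintegral (Icc a b) _)
  refine setLIntegral_mono (by fun_prop) fun y hy => ?_
  have h1 : ‖x - y‖ₑ ≤ ENNReal.ofReal (b - a) := by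
    rw [← ofReal_norm, Real.norm_eq_abs]
    apply ENNReal.ofReal_le_ofReal
    rw [abs_le]; constructor <;> linarith [hx.1, hx.2, hy.1, hy.2]
  rw [ENNReal.rpow_neg, ← div_eq_mul_inv]
  rcases eq_or_ne (‖x - y‖ₑ ^ κ) 0 with h0 | h0
  · rw [h0, ENNReal.div_zero]
    · exact le_top
    · simp [ENNReal.rpow_eq_zero_iff, hab, not_lt.2 hκ.le]
  · rw [ENNReal.le_div_iff_mul_le (Or.inl h0)
      (Or.inl (ENNReal.rpow_ne_top_of_nonneg hκ.le enorm_ne_top)), one_mul]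
    exact ENNReal.rpow_le_rpow h1 hκ.le

theorem integral_gaussKernel_comm (ε : ℝ) (φ : ℝ → ℝ) (z : ℝ) :
    ∫ y, gaussKernel ε (z - y) * φ y = ∫ u, gaussKernel ε u * φ (z - u) := by
  rw [← integral_sub_left_eq_self (fun y => gaussKernel ε (z - y) * φ y) volume z]
  simp

/-- Mollification does not increase the local oscillation of a monotone function, as measured by the
Riesz potential of its measure. -/
theorem ofReal_mollified_sub_le_rieszPotential [SFinite ν] {ε : ℝ} (hε : 0 < ε) (hκ0 : 0 < κ)
    (hκ1 : κ < 1) (hφ : Monotone φ)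
    (hν : ∀ a b, a ≤ b → ENNReal.ofReal (φ b - φ a) ≤ ν (Icc a b))
    (hint : ∀ z, Integrable fun u => gaussKernel ε u * φ (z - u))
    {a b x : ℝ} (hx : x ∈ Icc a b) :
    ENNReal.ofReal ((∫ u, gaussKernel ε u * φ (b - u)) - ∫ u, gaussKernel ε u * φ (a - u))
      ≤ ENNReal.ofReal (b - a) ^ κ * (2 * rieszPotential κ ν x) := by
  rcases (hx.1.trans hx.2).eq_or_lt with rfl | hab
  · simp
  have hint' : Integrable fun u => gaussKernel ε u * φ (b - u) - gaussKernel ε u * φ (a - u) :=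
    (hint b).sub (hint a)
  rw [← integral_sub (hint b) (hint a), ofReal_integral_eq_lintegral_ofReal hint'
    (Eventually.of_forall fun u => by
      simp only [Pi.zero_apply, ← mul_sub]
      exact mul_nonneg (gaussKernel_nonneg _ _) (sub_nonneg.2 (hφ (by linarith))))]
  have hS : MeasurableSet {p : ℝ × ℝ | p.2 + p.1 ∈ Icc a b} :=
    measurableSet_Icc.preimage (by fun_prop)
  have hG : Measurable fun p : ℝ × ℝ => ENNReal.ofReal (gaussKernel ε p.1) :=
    ((continuous_gaussKernel ε).measurable.comp measurable_fst).ennreal_ofReal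
  -- After Fubini the inner integral is the Gaussian mass of `[a - y, b - y]`, an interval of length
  -- `b - a` containing `x - y`.
  calc ∫⁻ u, ENNReal.ofReal (gaussKernel ε u * φ (b - u) - gaussKernel ε u * φ (a - u))
      ≤ ∫⁻ u, ∫⁻ y, {p : ℝ × ℝ | p.2 + p.1 ∈ Icc a b}.indicator
          (fun p : ℝ × ℝ => ENNReal.ofReal (gaussKernel ε p.1)) (u, y) ∂ν := by
        refine lintegral_mono fun u => ?_
        rw [← mul_sub, ENNReal.ofReal_mul (gaussKernel_nonneg _ _)]
        refine (mul_le_mul_right (hν (a - u) (b - u) (by linarith)) _).trans ?_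
        rw [← setLIntegral_const, ← lintegral_indicator measurableSet_Icc]
        refine lintegral_mono fun y => ?_
        by_cases hy : y ∈ Icc (a - u) (b - u)
        · rw [indicator_of_mem hy, indicator_of_mem]
          exact ⟨by linarith [hy.1], by linarith [hy.2]⟩
        · rw [indicator_of_notMem hy]
          exact zero_le
    _ = ∫⁻ y, ∫⁻ u, {p : ℝ × ℝ | p.2 + p.1 ∈ Icc a b}.indicator
          (fun p : ℝ × ℝ => ENNReal.ofReal (gaussKernel ε p.1)) (u, y) ∂volume ∂ν :=
        lintegral_lintegral_swap (hG.indicator hS).aemeasurable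
    _ ≤ ∫⁻ y, ENNReal.ofReal (b - a) ^ κ * (2 * ‖x - y‖ₑ ^ (-κ)) ∂ν := by
        refine lintegral_mono fun y => ?_
        have := lintegral_gaussKernel_Icc_le hε hκ0 hκ1 (c := a - y) (d := b - y) (z := x - y)
          (by linarith) ⟨by linarith [hx.1], by linarith [hx.2]⟩
        rw [← lintegral_indicator measurableSet_Icc, sub_sub_sub_cancel_right, mul_assoc,
          mul_left_comm] at this
        refine le_trans (lintegral_mono fun u => ?_) this
        by_cases hu : y + u ∈ Icc a b
        · rw [indicator_of_mem (by exact hu), indicator_of_mem]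
          exact ⟨by linarith [hu.1], by linarith [hu.2]⟩
        · rw [indicator_of_notMem (by exact hu)]
          exact zero_le
    _ = _ := by
        rw [lintegral_const_mul _ (by fun_prop), lintegral_const_mul _ (by fun_prop), rieszPotential]

end Potential

/-! ### Uniform oscillation bounds and convergence of the mollifications. -/

section Mollify

variable {φ : ℝ → ℝ} {κ M : ℝ} {N : ℕ}

/-- Convolution with the Gaussian kernel of variance `1 / n`. -/
noncomputable def mollify (φ : ℝ → ℝ) (n : ℕ) (z : ℝ) : ℝ :=
  ∫ y, gaussKernel (1 / (n : ℝ)) (z - y) * φ y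

theorem mollify_eq (φ : ℝ → ℝ) (n : ℕ) (z : ℝ) :
    mollify φ n z = ∫ u, gaussKernel (1 / (n : ℝ)) u * φ (z - u) :=
  integral_gaussKernel_comm _ _ _

theorem integrable_gaussKernel_mul_sub {n : ℕ} {z : ℝ}
    (h : Integrable fun y => gaussKernel (1 / (n : ℝ)) (z - y) * φ y) :
    Integrable fun u => gaussKernel (1 / (n : ℝ)) u * φ (z - u) := by
  simpa using h.comp_sub_left z

theorem one_div_natCast_pos {n : ℕ} (hn : 0 < n) : (0 : ℝ) < 1 / n := by
  have : (0 : ℝ) < n := by exact_mod_cast hn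
  positivity

/-- All mollifications become integrals against one kernel, with `n` only in the shift; this permits
a single dominating function. -/
theorem mollify_eq_rescale {n : ℕ} (hN : 0 < N) (hn : 0 < n) (z : ℝ) :
    mollify φ n z
      = ∫ v, gaussKernel (1 / (N : ℝ)) v * φ (z - Real.sqrt (N / n) * v) := by
  have hN' : (0 : ℝ) < N := by exact_mod_cast hN
  have hn' : (0 : ℝ) < n := by exact_mod_cast hn
  have hc : 0 < Real.sqrt (N / n) := Real.sqrt_pos.2 (by positivity)
  simp_rw [← gaussKernel_rescale hN hn, mul_assoc]
  rw [integral_const_mul, Measure.integral_comp_mul_left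
    (fun u => gaussKernel (1 / (n : ℝ)) u * φ (z - u)), ← mollify_eq, abs_of_pos (inv_pos.2 hc),
    smul_eq_mul, mul_inv_cancel_left₀ hc.ne']

theorem Monotone.abs_shift_le (hφ : Monotone φ) {c : ℝ} (hc0 : 0 ≤ c) (hc1 : c ≤ 1) (z v : ℝ) :
    |φ (z - c * v)| ≤ |φ (z - v)| + |φ (z + v)| := by
  have h1 : |c * v| ≤ |v| := by
    rw [abs_mul, abs_of_nonneg hc0]; exact mul_le_of_le_one_left (abs_nonneg _) hc1
  have h2 := hφ (show z - |v| ≤ z - c * v by linarith [le_abs_self (c * v)])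
  have h3 := hφ (show z - c * v ≤ z + |v| by linarith [neg_abs_le (c * v)])
  have h4 : |φ (z - |v|)| + |φ (z + |v|)| = |φ (z - v)| + |φ (z + v)| := by
    rcases abs_cases v with ⟨h, -⟩ | ⟨h, -⟩ <;> rw [h]
    rw [sub_neg_eq_add, ← sub_eq_add_neg, add_comm]
  rw [← h4, abs_le]
  constructor
  · linarith [neg_abs_le (φ (z - |v|)), abs_nonneg (φ (z + |v|))]
  · linarith [le_abs_self (φ (z + |v|)), abs_nonneg (φ (z - |v|))]

theorem integrable_dominating (hint : ∀ z : ℝ, Integrable fun y =>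
      gaussKernel (1 / (N : ℝ)) (z - y) * φ y) (z : ℝ) :
    Integrable fun v => gaussKernel (1 / (N : ℝ)) v * (|φ (z - v)| + |φ (z + v)|) := by
  have h1 := integrable_gaussKernel_mul_sub (hint z)
  have h2 : Integrable fun v => gaussKernel (1 / (N : ℝ)) v * φ (z + v) := by
    have := h1.comp_neg
    simpa [gaussKernel_neg] using this
  refine (h1.abs.add h2.abs).congr (Eventually.of_forall fun v => ?_)
  simp only [Pi.add_apply, abs_mul, abs_of_nonneg (gaussKernel_nonneg _ _)]
  ring

theorem sqrt_div_le_one {n : ℕ} (hN : 0 < N) (hn : N ≤ n) : Real.sqrt ((N : ℝ) / n) ≤ 1 := by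
  have hN' : (0 : ℝ) < N := by exact_mod_cast hN
  have hn' : (N : ℝ) ≤ n := by exact_mod_cast hn
  rw [Real.sqrt_le_one, div_le_one (by linarith)]
  exact hn'

theorem abs_mollify_le (hφ : Monotone φ) (hN : 0 < N) (hint : ∀ z : ℝ, Integrable fun y =>
      gaussKernel (1 / (N : ℝ)) (z - y) * φ y) {n : ℕ} (hn : N ≤ n) (z : ℝ) :
    |mollify φ n z|
      ≤ ∫ v, gaussKernel (1 / (N : ℝ)) v * (|φ (z - v)| + |φ (z + v)|) := by
  rw [mollify_eq_rescale hN (hN.trans_le hn)]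
  rw [← Real.norm_eq_abs]
  refine norm_integral_le_of_norm_le (integrable_dominating hint z) (Eventually.of_forall fun v => ?_)
  rw [norm_mul, Real.norm_eq_abs, Real.norm_eq_abs, abs_of_nonneg (gaussKernel_nonneg _ _)]
  exact mul_le_mul_of_nonneg_left
    (Monotone.abs_shift_le hφ (Real.sqrt_nonneg _) (sqrt_div_le_one hN hn) z v)
    (gaussKernel_nonneg _ _)

theorem tendsto_mollify (hφ : Monotone φ) (hN : 0 < N) (hint : ∀ z : ℝ, Integrable fun y =>
      gaussKernel (1 / (N : ℝ)) (z - y) * φ y) {z : ℝ} (hz : ContinuousAt φ z) :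
    Tendsto (fun n => mollify φ n z) atTop (𝓝 (φ z)) := by
  have e : φ z = ∫ v, gaussKernel (1 / (N : ℝ)) v * φ z := by
    rw [integral_mul_const, integral_gaussKernel (one_div_natCast_pos hN), one_mul]
  have key : Tendsto (fun n : ℕ => ∫ v, gaussKernel (1 / (N : ℝ)) v * φ (z - Real.sqrt (N / n) * v))
      atTop (𝓝 (∫ v, gaussKernel (1 / (N : ℝ)) v * φ z)) := by
    refine tendsto_integral_filter_of_dominated_convergence
      (fun v => gaussKernel (1 / (N : ℝ)) v * (|φ (z - v)| + |φ (z + v)|)) ?_ ?_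
      (integrable_dominating hint z) ?_
    · refine Eventually.of_forall fun n => Measurable.aestronglyMeasurable ?_
      exact (continuous_gaussKernel _).measurable.mul (hφ.measurable.comp (by fun_prop))
    · filter_upwards [eventually_ge_atTop N] with n hn
      refine Eventually.of_forall fun v => ?_
      rw [norm_mul, Real.norm_eq_abs, Real.norm_eq_abs, abs_of_nonneg (gaussKernel_nonneg _ _)]
      exact mul_le_mul_of_nonneg_left
        (Monotone.abs_shift_le hφ (Real.sqrt_nonneg _) (sqrt_div_le_one hN hn) z v)
        (gaussKernel_nonneg _ _)
    · refine Eventually.of_forall fun v => Tendsto.const_mul _ (hz.tendsto.comp ?_)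
      have h1 : Tendsto (fun n : ℕ => Real.sqrt ((N : ℝ) / n)) atTop (𝓝 (Real.sqrt 0)) :=
        (Real.continuous_sqrt.tendsto 0).comp (tendsto_const_div_atTop_nhds_zero_nat _)
      rw [Real.sqrt_zero] at h1
      simpa using tendsto_const_nhds.sub (h1.mul_const v)
  rw [e]
  refine key.congr' ?_
  filter_upwards [eventually_ge_atTop N] with n hn
  rw [mollify_eq_rescale hN (hN.trans_le hn)]

theorem monotone_mollify (hφ : Monotone φ) {n : ℕ} (hint : ∀ z : ℝ, Integrable fun y =>
      gaussKernel (1 / (n : ℝ)) (z - y) * φ y) : Monotone (mollify φ n) := by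
  intro a b hab
  rw [mollify_eq, mollify_eq]
  exact integral_mono (integrable_gaussKernel_mul_sub (hint a))
    (integrable_gaussKernel_mul_sub (hint b)) fun u =>
      mul_le_mul_of_nonneg_left (hφ (by linarith)) (gaussKernel_nonneg _ _)

/-- Control of the oscillation of `ψ` on subintervals of `[-M, M]` by the values of `W` inside. -/
def OscBound (κ M A : ℝ) (W : ℝ → ℝ≥0∞) (ψ : ℝ → ℝ) : Prop :=
  ∀ a b x y z, -M ≤ a → b ≤ M → x ∈ Icc a b → y ∈ Icc a b → z ∈ Icc a b → W x ≠ ∞ →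
    |ψ y - ψ z| ≤ A * (b - a) ^ κ * (1 + (W x).toReal)

theorem le_rpow_of_le {L κ M h : ℝ} (hL : 0 ≤ L) (hκ1 : κ < 1) (hh : 0 ≤ h)
    (hM : h ≤ 2 * M) : L * h ≤ L * (2 * M) ^ (1 - κ) * h ^ κ := by
  rcases hh.eq_or_lt with rfl | hh
  · rw [mul_zero]
    exact mul_nonneg (mul_nonneg hL (Real.rpow_nonneg hM _)) (Real.rpow_nonneg le_rfl _)
  have h1 : h = h ^ (1 - κ) * h ^ κ := by
    rw [← Real.rpow_add hh, sub_add_cancel, Real.rpow_one]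
  have h2 : h ^ (1 - κ) ≤ (2 * M) ^ (1 - κ) := Real.rpow_le_rpow hh.le hM (by linarith)
  calc L * h = L * (h ^ (1 - κ) * h ^ κ) := by rw [← h1]
    _ ≤ L * ((2 * M) ^ (1 - κ) * h ^ κ) := by gcongr
    _ = _ := by ring

/-- The increment is split into a part `d` from the truncated function, bounded by the potential,
and a Lipschitz part `e` from the tails. -/
theorem Monotone.oscBound {ψ : ℝ → ℝ} {W : ℝ → ℝ≥0∞} {L : ℝ} (hψ : Monotone ψ) (hL : 0 ≤ L)
    (hκ1 : κ < 1)
    (h : ∀ a b x, -M ≤ a → b ≤ M → x ∈ Icc a b →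
      ∃ d e, ψ b - ψ a = d + e ∧ ENNReal.ofReal d ≤ ENNReal.ofReal (b - a) ^ κ * (2 * W x) ∧
        e ≤ L * (b - a)) (hκ0 : 0 < κ) :
    OscBound κ M (2 + L * (2 * M) ^ (1 - κ)) W ψ := by
  intro a b x y z ha hb hx hy hz hW
  have hab : a ≤ b := hx.1.trans hx.2
  have h1 : |ψ y - ψ z| ≤ ψ b - ψ a := by
    have := hψ hy.1
    have := hψ hy.2
    have := hψ hz.1
    have := hψ hz.2
    rw [abs_le]; constructor <;> linarith
  obtain ⟨d, e, hde, hd, he⟩ := h a b x ha hb hx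
  have hd' : d ≤ (b - a) ^ κ * (2 * (W x).toReal) := by
    have hfin : ENNReal.ofReal (b - a) ^ κ * (2 * W x) ≠ ∞ :=
      ENNReal.mul_ne_top (ENNReal.rpow_ne_top_of_nonneg hκ0.le ENNReal.ofReal_ne_top)
        (ENNReal.mul_ne_top ENNReal.ofNat_ne_top hW)
    have := (ENNReal.ofReal_le_iff_le_toReal hfin).1 hd
    rwa [ENNReal.toReal_mul, ENNReal.toReal_mul, ← ENNReal.toReal_rpow,
      ENNReal.toReal_ofReal (sub_nonneg.2 hab), ENNReal.toReal_ofNat] at this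
  have he' := he.trans (le_rpow_of_le (M := M) hL hκ1 (sub_nonneg.2 hab) (by linarith))
  have hp : 0 ≤ (b - a) ^ κ := Real.rpow_nonneg (sub_nonneg.2 hab) _
  have hLp : 0 ≤ L * (2 * M) ^ (1 - κ) :=
    mul_nonneg hL (Real.rpow_nonneg (by linarith) _)
  have hWr : 0 ≤ (W x).toReal := ENNReal.toReal_nonneg
  have e3 : 0 ≤ L * (2 * M) ^ (1 - κ) * (b - a) ^ κ * (W x).toReal := by positivity
  calc |ψ y - ψ z| ≤ d + e := by rw [← hde]; exact h1
    _ ≤ (b - a) ^ κ * (2 * (W x).toReal) + L * (2 * M) ^ (1 - κ) * (b - a) ^ κ := add_le_add hd' he'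
    _ ≤ _ := by nlinarith

theorem Monotone.comp_clampTo (hφ : Monotone φ) (c d : ℝ) : Monotone fun y => φ (clampTo c d y) :=
  hφ.comp (clampTo_monotone c d)

theorem Monotone.abs_comp_clampTo_le (hφ : Monotone φ) {R : ℝ} (hR : 0 ≤ R) (y : ℝ) :
    |φ (clampTo (-R) R y)| ≤ |φ (-R)| + |φ R| := by
  have h := clampTo_mem (show -R ≤ R by linarith) y
  have h1 := hφ h.1
  have h2 := hφ h.2
  rw [abs_le]
  constructor
  · linarith [neg_abs_le (φ (-R)), abs_nonneg (φ R)]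
  · linarith [le_abs_self (φ R), abs_nonneg (φ (-R))]

theorem integrable_gaussKernel_mul_clamp (hφ : Monotone φ) {R : ℝ} (hR : 0 ≤ R) {n : ℕ}
    (hn : 0 < n) (z : ℝ) :
    Integrable fun y => gaussKernel (1 / (n : ℝ)) (z - y) * φ (clampTo (-R) R y) := by
  refine ((integrable_gaussKernel (one_div_natCast_pos hn)).comp_sub_left z).mul_bdd
    (c := |φ (-R)| + |φ R|) ?_ (Eventually.of_forall fun y => ?_)
  · exact (Monotone.comp_clampTo hφ _ _).measurable.aestronglyMeasurable
  · exact Monotone.abs_comp_clampTo_le hφ hR y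

/-- A monotone function and its Gaussian mollifications have a common oscillation bound in terms of
a Riesz potential. -/
theorem Monotone.exists_oscBound (hφ : Monotone φ) (hN : 1 ≤ N)
    (hint : ∀ n ≥ N, ∀ z : ℝ, Integrable fun y => gaussKernel (1 / (n : ℝ)) (z - y) * φ y)
    (hκ0 : 0 < κ) (hκ1 : κ < 1) (hM : 0 ≤ M) :
    ∃ ν : Measure ℝ, IsFiniteMeasure ν ∧ ∃ A, 0 ≤ A ∧ OscBound κ M A (rieszPotential κ ν) φ ∧
      ∀ n ≥ N, OscBound κ M A (rieszPotential κ ν) (mollify φ n) := by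
  have hR : 0 ≤ M + 1 := by linarith
  obtain ⟨ν, hν, hν'⟩ := Monotone.exists_clamp_measure hφ hR
  -- `φ` frozen outside `[-(M + 1), M + 1]`. The margin 1 keeps the support of `φ - φ₁` away from
  -- `[-M, M]`, where kernel derivatives are uniformly dominated.
  set φ₁ : ℝ → ℝ := fun y => φ (clampTo (-(M + 1)) (M + 1) y) with hφ₁
  have hφ₁m : Monotone φ₁ := Monotone.comp_clampTo hφ _ _
  have hφ₁eq : ∀ y, |y| ≤ M + 1 → φ₁ y = φ y := fun y hy => by
    rw [hφ₁]; simp only; rw [clampTo_of_mem ⟨(abs_le.1 hy).1, (abs_le.1 hy).2⟩]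
  have hint₁ : ∀ n ≥ N, ∀ z : ℝ, Integrable fun y => gaussKernel (1 / (n : ℝ)) (z - y) * φ₁ y :=
    fun n hn z => integrable_gaussKernel_mul_clamp hφ hR (by omega) z
  have hint₂ : ∀ n ≥ N, ∀ z : ℝ,
      Integrable fun y => gaussKernel (1 / (n : ℝ)) (z - y) * (φ y - φ₁ y) := fun n hn z => by
    simp only [mul_sub]
    exact (hint n hn z).sub (hint₁ n hn z)
  set G : ℝ → ℝ := fun y => 8 * (gaussKernel (1 / (N : ℝ)) (M + 1 - y)
    + gaussKernel (1 / (N : ℝ)) (-(M + 1) - y)) * |φ y - φ₁ y| with hG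
  have hGint : Integrable G := by
    refine (((hint₂ N le_rfl (M + 1)).abs.add (hint₂ N le_rfl (-(M + 1))).abs).const_mul 8).congr
      (Eventually.of_forall fun y => ?_)
    simp only [hG, Pi.add_apply, abs_mul, abs_of_nonneg (gaussKernel_nonneg _ _)]
    ring
  -- A Lipschitz constant on `[-M, M]` for the mollified tails, valid for every `n ≥ N`.
  set L := ∫ y, G y with hL
  have hG0 : ∀ y, 0 ≤ G y := fun y =>
    mul_nonneg (mul_nonneg (by norm_num) (add_nonneg (gaussKernel_nonneg _ _)
      (gaussKernel_nonneg _ _))) (abs_nonneg _)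
  have hL0 : 0 ≤ L := integral_nonneg hG0
  refine ⟨ν, hν, 2 + L * (2 * M) ^ (1 - κ), by positivity, ?_, fun n hn => ?_⟩
  · refine Monotone.oscBound hφ hL0 hκ1 (fun a b x ha hb hx => ?_) hκ0
    have hab := hx.1.trans hx.2
    refine ⟨φ b - φ a, 0, by ring, ?_, mul_nonneg hL0 (sub_nonneg.2 hab)⟩
    have := ofReal_sub_le_rieszPotential (φ := φ₁) hκ0 hν' hx
    rw [hφ₁eq b (abs_le.2 ⟨by linarith, by linarith⟩),
      hφ₁eq a (abs_le.2 ⟨by linarith, by linarith⟩)] at this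
    refine this.trans (mul_le_mul_right ?_ _)
    rw [two_mul]
    exact le_self_add
  · have hn0 : 0 < n := by omega
    refine Monotone.oscBound (monotone_mollify hφ (hint n hn)) hL0 hκ1 (fun a b x ha hb hx => ?_) hκ0
    have hab := hx.1.trans hx.2
    refine ⟨mollify φ₁ n b - mollify φ₁ n a,
      ∫ y, (gaussKernel (1 / (n : ℝ)) (b - y) - gaussKernel (1 / (n : ℝ)) (a - y)) * (φ y - φ₁ y),
      ?_, ?_, ?_⟩
    · simp only [sub_mul]
      rw [integral_sub (hint₂ n hn b) (hint₂ n hn a)]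
      simp only [mul_sub]
      rw [integral_sub (hint n hn b) (hint₁ n hn b), integral_sub (hint n hn a) (hint₁ n hn a)]
      simp only [mollify]
      ring
    · rw [mollify_eq, mollify_eq]
      exact ofReal_mollified_sub_le_rieszPotential (one_div_natCast_pos hn0) hκ0 hκ1 hφ₁m hν'
        (fun z => integrable_gaussKernel_mul_sub (hint₁ n hn z)) hx
    · have hle : ∀ y, ‖(gaussKernel (1 / (n : ℝ)) (b - y) - gaussKernel (1 / (n : ℝ)) (a - y))
          * (φ y - φ₁ y)‖ ≤ G y * (b - a) := by
        intro y
        rw [norm_mul, Real.norm_eq_abs, Real.norm_eq_abs]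
        rcases le_total (M + 1) |y| with h1 | h1
        · refine (mul_le_mul_of_nonneg_right (abs_gaussKernel_sub_le hN hn ha hab hb h1)
            (abs_nonneg _)).trans_eq ?_
          rw [hG]; ring
        · rw [hφ₁eq y h1, sub_self, abs_zero, mul_zero]
          exact mul_nonneg (hG0 y) (sub_nonneg.2 hab)
      have := norm_integral_le_of_norm_le (hGint.mul_const (b - a)) (Eventually.of_forall hle)
      rw [integral_mul_const] at this
      exact (le_abs_self _).trans this

/-- Apply the bound on symmetric intervals shrinking to `x`. Hence mollifications converge wherever
the potential is finite. -/
theorem OscBound.continuousAt {A : ℝ} {W : ℝ → ℝ≥0∞} {ψ : ℝ → ℝ} (hκ0 : 0 < κ)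
    (h : OscBound κ M A W ψ) {x : ℝ} (hx : x ∈ Ioo (-M) M) (hW : W x ≠ ∞) : ContinuousAt ψ x := by
  have hlim : Tendsto (fun y => A * (2 * |y - x|) ^ κ * (1 + (W x).toReal)) (𝓝 x) (𝓝 0) := by
    have h1 : Tendsto (fun y : ℝ => 2 * |y - x|) (𝓝 x) (𝓝 0) := by
      have : ContinuousAt (fun y : ℝ => 2 * |y - x|) x := by fun_prop
      simpa [ContinuousAt] using this
    have h2 := h1.rpow_const (p := κ) (Or.inr hκ0.le)
    rw [Real.zero_rpow hκ0.ne'] at h2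
    simpa using (h2.const_mul A).mul_const (1 + (W x).toReal)
  rw [ContinuousAt, tendsto_iff_dist_tendsto_zero]
  have hnear : ∀ᶠ y in 𝓝 x, |y - x| < min (x + M) (M - x) := by
    have : 0 < min (x + M) (M - x) := lt_min (by linarith [hx.1]) (by linarith [hx.2])
    filter_upwards [Metric.ball_mem_nhds x this] with y hy
    simpa [Real.dist_eq] using hy
  refine squeeze_zero' (Eventually.of_forall fun _ => dist_nonneg) ?_ hlim
  filter_upwards [hnear] with y hy
  have h1 := hy.trans_le (min_le_left _ _)
  have h2 := hy.trans_le (min_le_right _ _)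
  have := h (x - |y - x|) (x + |y - x|) x y x (by linarith) (by linarith)
    ⟨by linarith [abs_nonneg (y - x)], by linarith [abs_nonneg (y - x)]⟩
    ⟨by linarith [neg_abs_le (y - x)], by linarith [le_abs_self (y - x)]⟩
    ⟨by linarith [abs_nonneg (y - x)], by linarith [abs_nonneg (y - x)]⟩ hW
  rw [Real.dist_eq]
  have e : x + |y - x| - (x - |y - x|) = 2 * |y - x| := by ring
  rwa [e] at this

/-- Products with Lipschitz functions preserve oscillation bounds. -/
theorem OscBound.mul_lipschitz {A K₁ K₂ : ℝ} {K : ℝ≥0} {W : ℝ → ℝ≥0∞} {ψ σ : ℝ → ℝ}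
    (hκ1 : κ < 1) (h : OscBound κ M A W ψ) (hσ : LipschitzWith K σ)
    (h1 : ∀ x ∈ Icc (-M) M, |ψ x| ≤ K₁) (h2 : ∀ x ∈ Icc (-M) M, |σ x| ≤ K₂) :
    OscBound κ M (K₂ * A + K₁ * (K * (2 * M) ^ (1 - κ))) W fun x => ψ x * σ x := by
  intro a b x y z ha hb hx hy hz hW
  have hab : a ≤ b := hx.1.trans hx.2
  have hmem : ∀ w ∈ Icc a b, w ∈ Icc (-M) M := fun w hw => ⟨ha.trans hw.1, hw.2.trans hb⟩
  have e1 := h a b x y z ha hb hx hy hz hW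
  have e2 : |σ y - σ z| ≤ K * (2 * M) ^ (1 - κ) * (b - a) ^ κ := by
    have := hσ.dist_le_mul y z
    rw [Real.dist_eq, Real.dist_eq] at this
    have hyz : |y - z| ≤ b - a := by
      rw [abs_le]; constructor <;> linarith [hy.1, hy.2, hz.1, hz.2]
    exact (this.trans (mul_le_mul_of_nonneg_left hyz K.2)).trans
      (le_rpow_of_le K.2 hκ1 (sub_nonneg.2 hab) (by linarith))
  have k1 := h1 z (hmem z hz)
  have k2 := h2 y (hmem y hy)
  have hK₁ : 0 ≤ K₁ := (abs_nonneg _).trans k1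
  have hK₂ : 0 ≤ K₂ := (abs_nonneg _).trans k2
  have hWr : 0 ≤ (W x).toReal := ENNReal.toReal_nonneg
  have hB : 0 ≤ K * (2 * M) ^ (1 - κ) * (b - a) ^ κ := (abs_nonneg _).trans e2
  have e3 : ψ y * σ y - ψ z * σ z = (ψ y - ψ z) * σ y + ψ z * (σ y - σ z) := by ring
  calc |ψ y * σ y - ψ z * σ z| ≤ |ψ y - ψ z| * |σ y| + |ψ z| * |σ y - σ z| := by
        rw [e3, ← abs_mul, ← abs_mul]; exact abs_add_le _ _
    _ ≤ (A * (b - a) ^ κ * (1 + (W x).toReal)) * K₂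
        + K₁ * (K * (2 * M) ^ (1 - κ) * (b - a) ^ κ) :=
      add_le_add (mul_le_mul e1 k2 (abs_nonneg _) ((abs_nonneg _).trans e1))
        (mul_le_mul k1 e2 (abs_nonneg _) hK₁)
    _ ≤ _ := by nlinarith [mul_nonneg (mul_nonneg hK₁ hB) hWr]

/-- Monotonicity reduces the bound to the endpoints `±M`, where the dominating integral does not
depend on `n`. -/
theorem Monotone.exists_bound_mollify (hφ : Monotone φ) (hN : 1 ≤ N)
    (hint : ∀ n ≥ N, ∀ z : ℝ, Integrable fun y => gaussKernel (1 / (n : ℝ)) (z - y) * φ y) (M : ℝ) :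
    ∃ K, (∀ x ∈ Icc (-M) M, |φ x| ≤ K) ∧ ∀ n ≥ N, ∀ x ∈ Icc (-M) M, |mollify φ n x| ≤ K := by
  set D : ℝ → ℝ := fun z => ∫ v, gaussKernel (1 / (N : ℝ)) v * (|φ (z - v)| + |φ (z + v)|) with hD
  have hD0 : ∀ z, 0 ≤ D z := fun z => integral_nonneg fun v =>
    mul_nonneg (gaussKernel_nonneg _ _) (by positivity)
  refine ⟨|φ (-M)| + |φ M| + D (-M) + D M, fun x hx => ?_, fun n hn x hx => ?_⟩
  · have h1 := hφ hx.1
    have h2 := hφ hx.2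
    have := hD0 M
    have := hD0 (-M)
    rw [abs_le]
    constructor
    · linarith [neg_abs_le (φ (-M)), abs_nonneg (φ M)]
    · linarith [le_abs_self (φ M), abs_nonneg (φ (-M))]
  · have hm := monotone_mollify hφ (hint n hn)
    have h1 := hm hx.1
    have h2 := hm hx.2
    have b1 := abs_le.1 (abs_mollify_le hφ (by omega) (hint N le_rfl) hn (-M))
    have b2 := abs_le.1 (abs_mollify_le hφ (by omega) (hint N le_rfl) hn M)
    have := hD0 M
    have := hD0 (-M)
    have := abs_nonneg (φ M)
    have := abs_nonneg (φ (-M))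
    rw [abs_le]
    constructor <;> linarith [b1.1, b1.2, b2.1, b2.2]

end Mollify

/-! ### Expected Riesz potential under a bounded density. -/

section Energy

theorem intervalIntegrable_abs_rpow {κ : ℝ} (hκ1 : κ < 1) :
    IntervalIntegrable (fun z : ℝ => |z| ^ (-κ)) volume (-1) 1 := by
  have h1 : IntervalIntegrable (fun z : ℝ => |z| ^ (-κ)) volume 0 1 := by
    refine (intervalIntegral.intervalIntegrable_rpow' (r := -κ) (by linarith)).congr ?_
    intro z hz
    rw [uIoc_of_le zero_le_one] at hz
    simp only [abs_of_pos hz.1]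
  have h2 : IntervalIntegrable (fun z : ℝ => |z| ^ (-κ)) volume 0 (-1) := by
    have := (IntervalIntegrable.iff_comp_neg (by simp)).1 h1
    simpa using this
  exact h2.symm.trans h1

theorem lintegral_enorm_rpow_lt_top {κ : ℝ} (hκ1 : κ < 1) :
    ∫⁻ z in Ioc (-1 : ℝ) 1, ‖z‖ₑ ^ (-κ) < ∞ := by
  have h1 := (intervalIntegrable_iff_integrableOn_Ioc_of_le (by norm_num)).1
    (intervalIntegrable_abs_rpow hκ1)
  have h2 := h1.2
  rw [hasFiniteIntegral_iff_enorm] at h2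
  refine lt_of_eq_of_lt (lintegral_congr_ae ?_) h2
  have h0 : ∀ᵐ z : ℝ ∂(volume.restrict (Ioc (-1) 1)), z ≠ 0 :=
    ae_restrict_of_ae (Measure.ae_ne volume 0)
  filter_upwards [h0] with z hz
  rw [← ofReal_norm, ← ofReal_norm, Real.norm_eq_abs, Real.norm_eq_abs,
    ENNReal.ofReal_rpow_of_pos (abs_pos.2 hz), abs_of_nonneg (Real.rpow_nonneg (abs_nonneg z) _)]

/-- The expectation of a Riesz potential under a law with bounded density. -/
theorem lintegral_mul_rieszPotential_le {κ : ℝ} (hκ0 : 0 < κ) {ν : Measure ℝ} [SFinite ν]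
    {q : ℝ → ℝ≥0∞} (hq : Measurable q) (hq1 : ∫⁻ x, q x ≤ 1) :
    ∫⁻ x, q x * rieszPotential κ ν x
      ≤ (∫⁻ z in Ioc (-1 : ℝ) 1, ‖z‖ₑ ^ (-κ)) * ν univ * (⨆ x, q x) + ν univ := by
  set c := ∫⁻ z in Ioc (-1 : ℝ) 1, ‖z‖ₑ ^ (-κ) with hc
  have hm : Measurable fun p : ℝ × ℝ => ‖p.1 - p.2‖ₑ ^ (-κ) := by fun_prop
  calc ∫⁻ x, q x * rieszPotential κ ν x
      = ∫⁻ x, ∫⁻ y, q x * ‖x - y‖ₑ ^ (-κ) ∂ν := by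
        refine lintegral_congr fun x => ?_
        rw [rieszPotential, lintegral_const_mul _ (by fun_prop)]
    _ = ∫⁻ y, ∫⁻ x, q x * ‖x - y‖ₑ ^ (-κ) ∂volume ∂ν :=
        lintegral_lintegral_swap ((hq.comp measurable_fst).mul hm).aemeasurable
    _ ≤ ∫⁻ _, (c * (⨆ x, q x) + 1) ∂ν := by
        refine lintegral_mono fun y => ?_
        -- Within distance 1 the density is replaced by its supremum; farther away the kernel is at
        -- most 1 and `q` has mass at most 1.
        have hpt : ∀ x, q x * ‖x - y‖ₑ ^ (-κ)
            ≤ (Ioc (-1 : ℝ) 1).indicator (fun z => ‖z‖ₑ ^ (-κ)) (x - y) * (⨆ x, q x) + q x := by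
          intro x
          by_cases hx : x - y ∈ Ioc (-1 : ℝ) 1
          · rw [indicator_of_mem hx, mul_comm]
            exact (mul_le_mul_right (le_iSup q x) _).trans le_self_add
          · rw [indicator_of_notMem hx, zero_mul, zero_add]
            refine mul_le_of_le_one_right' ?_
            rw [ENNReal.rpow_neg, ENNReal.inv_le_one]
            apply ENNReal.one_le_rpow _ hκ0
            rw [← ofReal_norm, Real.norm_eq_abs, ENNReal.one_le_ofReal]
            by_contra! hlt
            exact hx ⟨by linarith [(abs_lt.1 hlt).1], by linarith [(abs_lt.1 hlt).2]⟩
        have hmi : Measurable ((Ioc (-1 : ℝ) 1).indicator fun z : ℝ => ‖z‖ₑ ^ (-κ)) :=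
          Measurable.indicator (by fun_prop) measurableSet_Ioc
        calc ∫⁻ x, q x * ‖x - y‖ₑ ^ (-κ)
            ≤ ∫⁻ x, ((Ioc (-1 : ℝ) 1).indicator (fun z => ‖z‖ₑ ^ (-κ)) (x - y) * (⨆ x, q x) + q x) :=
              lintegral_mono hpt
          _ = (∫⁻ x, (Ioc (-1 : ℝ) 1).indicator (fun z => ‖z‖ₑ ^ (-κ)) (x - y)) * (⨆ x, q x)
              + ∫⁻ x, q x := by
              rw [lintegral_add_right _ hq, lintegral_mul_const]
              exact hmi.comp (measurable_id.sub_const y)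
          _ ≤ c * (⨆ x, q x) + 1 := by
              rw [lintegral_sub_right_eq_self (μ := volume)
                (fun z => (Ioc (-1 : ℝ) 1).indicator (fun z => ‖z‖ₑ ^ (-κ)) z) y,
                lintegral_indicator measurableSet_Ioc]
              exact add_le_add le_rfl hq1
    _ = _ := by
        rw [lintegral_const, add_mul, one_mul, mul_right_comm]

end Energy

/-! ### Joint measurability and integrability of the potential along paths. -/

section ContinuousPaths

variable {Ω : Type*} [MeasurableSpace Ω] {P : Measure Ω} {T : ℝ}
  {X : ℝ → Ω → ℝ}

/-- A process with almost surely continuous paths is jointly measurable. -/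
theorem aemeasurable_uncurry_of_ae_continuousOn (hm : ∀ t ∈ Icc (0 : ℝ) T, AEMeasurable (X t) P)
    (hc : ∀ᵐ ω ∂P, ContinuousOn (fun t => X t ω) (Icc 0 T)) :
    AEMeasurable (fun p : ℝ × Ω => X p.1 p.2) ((volume.restrict (Icc 0 T)).prod P) := by
  classical
  have hex : ∀ t : ℝ, ∃ Y : Ω → ℝ, Measurable Y ∧ (t ∈ Icc (0 : ℝ) T → X t =ᵐ[P] Y) := by
    intro t
    by_cases ht : t ∈ Icc (0 : ℝ) T
    · exact ⟨(hm t ht).mk _, (hm t ht).measurable_mk, fun _ => (hm t ht).ae_eq_mk⟩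
    · exact ⟨0, measurable_const, fun h => absurd h ht⟩
  choose Y hYm hYX using hex
  -- Sampling at dyadic floors uses countably many times, so measurable versions can be chosen
  -- outside one null set; the floors stay in `[0, T]`.
  refine aemeasurable_of_tendsto_metrizable_ae atTop
    (f := fun n p => Y (dyadicFloor n p.1) p.2) (fun n => ?_) ?_
  · have h1 : Measurable fun q : ℕ × Ω => Y ((q.1 : ℝ) / 2 ^ n) q.2 :=
      measurable_from_prod_countable_right fun k => hYm ((k : ℝ) / 2 ^ n)
    have h2 : Measurable fun p : ℝ × Ω => (⌊2 ^ n * p.1⌋₊, p.2) :=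
      (Nat.measurable_floor.comp (measurable_fst.const_mul _)).prodMk measurable_snd
    exact (h1.comp h2).aemeasurable
  · have hgood : ∀ᵐ ω ∂P, ∀ n k : ℕ, (k : ℝ) / 2 ^ n ∈ Icc (0 : ℝ) T →
        X ((k : ℝ) / 2 ^ n) ω = Y ((k : ℝ) / 2 ^ n) ω := by
      rw [ae_all_iff]; intro n
      rw [ae_all_iff]; intro k
      by_cases hk : (k : ℝ) / 2 ^ n ∈ Icc (0 : ℝ) T
      · filter_upwards [hYX _ hk] with ω hω _ using hω
      · exact Eventually.of_forall fun ω h => absurd h hk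
    have h1 : ∀ᵐ p : ℝ × Ω ∂((volume.restrict (Icc 0 T)).prod P), p.1 ∈ Icc 0 T :=
      Measure.quasiMeasurePreserving_fst.ae (ae_restrict_mem measurableSet_Icc)
    have h2 := Measure.quasiMeasurePreserving_snd (μ := volume.restrict (Icc 0 T)) (ν := P)
      |>.ae (hc.and hgood)
    filter_upwards [h1, h2] with p hp1 hp2
    have hmem : ∀ n, dyadicFloor n p.1 ∈ Icc 0 T := fun n =>
      ⟨dyadicFloor_nonneg _ _, (dyadicFloor_le hp1.1).trans hp1.2⟩
    have h3 : Tendsto (fun n => X (dyadicFloor n p.1) p.2) atTop (𝓝 (X p.1 p.2)) :=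
      (hp2.1 _ hp1).tendsto.comp (tendsto_nhdsWithin_iff.2
        ⟨tendsto_dyadicFloor hp1.1, Eventually.of_forall hmem⟩)
    exact h3.congr fun n => hp2.2 n _ (hmem n)

/-- The Riesz potential of a finite measure is almost surely integrable along the path. -/
theorem HasIntegrableSupDensity.ae_lintegral_rieszPotential_lt_top [IsProbabilityMeasure P]
    {p : ℝ → ℝ → ℝ≥0∞}
    (hp : HasIntegrableSupDensity P T X p)
    (hm : ∀ t ∈ Icc (0 : ℝ) T, AEMeasurable (X t) P)
    (hc : ∀ᵐ ω ∂P, ContinuousOn (fun t => X t ω) (Icc 0 T))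
    {κ : ℝ} (hκ0 : 0 < κ) (hκ1 : κ < 1) (ν : Measure ℝ) [IsFiniteMeasure ν] :
    ∀ᵐ ω ∂P, ∫⁻ t in Icc 0 T, rieszPotential κ ν (X t ω) < ∞ := by
  have hW : Measurable (rieszPotential κ ν) := measurable_rieszPotential κ
  have hj : AEMeasurable (fun q : ℝ × Ω => rieszPotential κ ν (X q.1 q.2))
      ((volume.restrict (Icc 0 T)).prod P) :=
    hW.comp_aemeasurable (aemeasurable_uncurry_of_ae_continuousOn hm hc)
  set c := ∫⁻ z in Ioc (-1 : ℝ) 1, ‖z‖ₑ ^ (-κ) with hcdef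
  have hctop : c < ∞ := lintegral_enorm_rpow_lt_top hκ1
  have hν : ν univ ≠ ∞ := measure_ne_top _ _
  have hbound : ∀ t ∈ Ioc (0 : ℝ) T, ∫⁻ ω, rieszPotential κ ν (X t ω) ∂P
      ≤ c * ν univ * (⨆ x, p t x) + ν univ := by
    intro t ht
    have hXt := hm t (Ioc_subset_Icc_self ht)
    have hmass : ∫⁻ x, p t x ≤ 1 := by
      have h1 : P.map (X t) univ = ∫⁻ x, p t x := by
        rw [hp.law t ht, withDensity_apply _ MeasurableSet.univ, Measure.restrict_univ]
      rw [← h1, Measure.map_apply_of_aemeasurable hXt MeasurableSet.univ]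
      exact prob_le_one
    rw [← lintegral_map' hW.aemeasurable hXt, hp.law t ht,
      lintegral_withDensity_eq_lintegral_mul _ (hp.measurable t ht) hW]
    exact lintegral_mul_rieszPotential_le hκ0 (hp.measurable t ht) hmass
  have hE : ∫⁻ ω, (∫⁻ t in Icc 0 T, rieszPotential κ ν (X t ω)) ∂P < ∞ := by
    rw [← lintegral_lintegral_swap hj]
    have h1 : ∀ᵐ t ∂(volume.restrict (Icc 0 T)), ∫⁻ ω, rieszPotential κ ν (X t ω) ∂P
        ≤ c * ν univ * (⨆ x, p t x) + ν univ := by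
      -- The law of `X_0` need not have a density; time 0 is removed as a null set.
      rw [← restrict_Ioc_eq_restrict_Icc]
      filter_upwards [ae_restrict_mem measurableSet_Ioc] with t ht using hbound t ht
    refine (lintegral_mono_ae h1).trans_lt ?_
    rw [lintegral_add_right _ measurable_const, lintegral_const,
      lintegral_const_mul'' _ hp.aemeasurable_sup]
    refine ENNReal.add_lt_top.2 ⟨ENNReal.mul_lt_top (ENNReal.mul_lt_top hctop hν.lt_top)
      hp.lintegral_sup, ENNReal.mul_lt_top hν.lt_top ?_⟩
    simp
  exact ae_lt_top' hj.lintegral_prod_left' hE.ne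

end ContinuousPaths

/-! ### From spatial oscillation to a control in time. -/

section Path

variable {T : ℝ} {w : ℝ → ℝ}

theorem integral_sub_integral_of_mem (hw : IntegrableOn w (Icc 0 T)) {s t : ℝ}
    (hs : s ∈ Icc 0 T) (ht : t ∈ Icc 0 T) :
    (∫ r in (0 : ℝ)..t, w r) - (∫ r in (0 : ℝ)..s, w r) = ∫ r in s..t, w r := by
  have h : ∀ x ∈ Icc 0 T, IntervalIntegrable w volume 0 x := fun x hx =>
    (intervalIntegrable_iff_integrableOn_Icc_of_le hx.1).2 (hw.mono_set (Icc_subset_Icc_right hx.2))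
  exact intervalIntegral.integral_interval_sub_left (h t ht) (h s hs)

/-- The summand 1 in the weight `1 + W (X r)` makes elapsed time at most the control, so spare
powers of `t - s` become powers of the control. -/
theorem sub_le_integral (hw : IntegrableOn w (Icc 0 T)) (hw1 : ∀ r, 1 ≤ w r) {s t : ℝ}
    (hs : 0 ≤ s) (hst : s ≤ t) (ht : t ≤ T) : t - s ≤ ∫ r in s..t, w r := by
  have h1 : IntervalIntegrable w volume s t :=
    (intervalIntegrable_iff_integrableOn_Icc_of_le hst).2 (hw.mono_set (Icc_subset_Icc hs ht))
  have := intervalIntegral.integral_mono_on hst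
    (intervalIntegrable_const (c := (1 : ℝ))) h1 (fun r _ => hw1 r)
  simpa using this

theorem mul_sub_le_integral (hw : IntegrableOn w (Icc 0 T)) {c q s t : ℝ}
    (hs : 0 ≤ s) (hst : s ≤ t) (ht : t ≤ T)
    (h : ∀ᵐ r ∂(volume.restrict (Icc s t)), c ≤ q * w r) :
    c * (t - s) ≤ q * ∫ r in s..t, w r := by
  have h1 : IntervalIntegrable w volume s t :=
    (intervalIntegrable_iff_integrableOn_Icc_of_le hst).2 (hw.mono_set (Icc_subset_Icc hs ht))
  have := intervalIntegral.integral_mono_ae_restrict hst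
    (intervalIntegrable_const (c := c)) (h1.const_mul q) h
  rw [intervalIntegral.integral_const, intervalIntegral.integral_const_mul, smul_eq_mul,
    mul_comm] at this
  exact this

/-- One interval of length at most `2C(t - s)^α` inside `[-M, M]` holds the whole path over `[s,
t]`, so any `X r` can serve as base point of the oscillation bound. -/
theorem mem_Icc_of_holder {X : ℝ → ℝ} {α C M : ℝ} (hα : 0 ≤ α) (hC : 0 ≤ C)
    (hXM : ∀ t ∈ Icc 0 T, X t ∈ Icc (-M) M)
    (hX : ∀ s ∈ Icc (0 : ℝ) T, ∀ t ∈ Icc (0 : ℝ) T, |X t - X s| ≤ C * |t - s| ^ α) {s t r : ℝ}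
    (hs : 0 ≤ s) (ht : t ≤ T) (hr : r ∈ Icc s t) :
    X r ∈ Icc (max (-M) (X s - C * (t - s) ^ α)) (min M (X s + C * (t - s) ^ α)) := by
  have hr' : r ∈ Icc 0 T := ⟨hs.trans hr.1, hr.2.trans ht⟩
  have hst : s ≤ t := hr.1.trans hr.2
  have h1 := hX s ⟨hs, hst.trans ht⟩ r hr'
  have h2 : |r - s| ^ α ≤ (t - s) ^ α := by
    rw [abs_of_nonneg (sub_nonneg.2 hr.1)]
    exact Real.rpow_le_rpow (sub_nonneg.2 hr.1) (by linarith [hr.2]) hα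
  have h3 := abs_le.1 (h1.trans (mul_le_mul_of_nonneg_left h2 hC))
  exact ⟨max_le (hXM r hr').1 (by linarith [h3.1]), le_min (hXM r hr').2 (by linarith [h3.2])⟩

/-- The spatial oscillation bound turns into a control of the Riemann–Stieltjes sums along Hölder
paths. -/
theorem OscBound.rsControl {X Y : ℝ → ℝ} {α κ C M A : ℝ} {W : ℝ → ℝ≥0∞} {ψ : ℝ → ℝ}
    (h : OscBound κ M A W ψ) (hA : 0 ≤ A) (hα : 0 < α) (hκ : 0 < κ) (hθ : 1 < α + α * κ)
    (hC : 0 ≤ C) (hXM : ∀ t ∈ Icc 0 T, X t ∈ Icc (-M) M)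
    (hX : ∀ s ∈ Icc (0 : ℝ) T, ∀ t ∈ Icc (0 : ℝ) T, |X t - X s| ≤ C * |t - s| ^ α)
    (hY : ∀ s ∈ Icc (0 : ℝ) T, ∀ t ∈ Icc (0 : ℝ) T, |Y t - Y s| ≤ C * |t - s| ^ α)
    (hw : IntegrableOn (fun r => 1 + (W (X r)).toReal) (Icc 0 T))
    (hfin : ∀ᵐ r ∂(volume.restrict (Icc 0 T)), W (X r) ≠ ∞) :
    RSControl (fun r => ψ (X r)) Y
      (fun t => (A * (2 * C) ^ κ * C) ^ (α + α * κ)⁻¹ * ∫ r in (0 : ℝ)..t, (1 + (W (X r)).toReal))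
      (α + α * κ) 0 T := by
  intro s t x y u v hs ht hx hy hu hv
  have hst : s ≤ t := hx.1.trans hx.2
  have hsT : s ∈ Icc 0 T := ⟨hs, hst.trans ht⟩
  have htT : t ∈ Icc 0 T := ⟨hs.trans hst, ht⟩
  have hw1 : ∀ r, 1 ≤ 1 + (W (X r)).toReal := fun r => by linarith [ENNReal.toReal_nonneg (a := W (X r))]
  rw [← mul_sub, integral_sub_integral_of_mem hw hsT htT]
  set I := ∫ r in s..t, (1 + (W (X r)).toReal) with hI
  have hlI : t - s ≤ I := sub_le_integral hw hw1 hs hst ht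
  have hQ : 0 ≤ A * (2 * C) ^ κ * C := by positivity
  have hI0 : 0 ≤ I := (sub_nonneg.2 hst).trans hlI
  rw [Real.mul_rpow (by positivity) hI0, Real.rpow_inv_rpow hQ (by linarith)]
  rcases hst.eq_or_lt with rfl | hlt
  · obtain rfl : x = s := le_antisymm hx.2 hx.1
    obtain rfl : y = x := le_antisymm hy.2 hy.1
    rw [sub_self, abs_zero, zero_mul]
    positivity
  have hl : 0 < t - s := sub_pos.2 hlt
  have hmem := fun r (hr : r ∈ Icc s t) => mem_Icc_of_holder hα.le hC hXM hX hs ht hr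
  set D := |ψ (X x) - ψ (X y)| with hD
  -- `D` does not depend on `r`, so this bound can be integrated over `[s, t]` and divided by `t -
  -- s`.
  have hosc : ∀ᵐ r ∂(volume.restrict (Icc s t)),
      D ≤ A * (2 * C * (t - s) ^ α) ^ κ * (1 + (W (X r)).toReal) := by
    have h1 := ae_restrict_of_ae_restrict_of_subset (Icc_subset_Icc hs ht) hfin
    filter_upwards [h1, ae_restrict_mem measurableSet_Icc] with r hr1 hr2
    have h2 := h _ _ (X r) (X x) (X y) (le_max_left _ _) (min_le_left _ _) (hmem r hr2)
      (hmem x hx) (hmem y hy) hr1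
    refine h2.trans ?_
    have h3 := (hmem x hx).1.trans (hmem x hx).2
    gcongr
    · linarith [le_max_right (-M) (X s - C * (t - s) ^ α), min_le_right M (X s + C * (t - s) ^ α)]
  have h4 := mul_sub_le_integral hw hs hst ht hosc
  rw [← hI, Real.mul_rpow (by positivity) (by positivity), ← Real.rpow_mul hl.le] at h4
  have h5 : |Y v - Y u| ≤ C * (t - s) ^ α := by
    refine (hY u ⟨hs.trans hu.1, hu.2.trans ht⟩ v ⟨hs.trans hv.1, hv.2.trans ht⟩).trans ?_
    have : |v - u| ≤ t - s := by
      rw [abs_le]; constructor <;> linarith [hu.1, hu.2, hv.1, hv.2]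
    gcongr
  have h6 : D ≤ A * (2 * C) ^ κ * (t - s) ^ (α * κ - 1) * I := by
    rw [Real.rpow_sub_one hl.ne']
    rw [← le_div_iff₀ hl] at h4
    refine h4.trans_eq ?_
    ring
  calc D * |Y v - Y u|
      ≤ (A * (2 * C) ^ κ * (t - s) ^ (α * κ - 1) * I) * (C * (t - s) ^ α) :=
        mul_le_mul h6 h5 (abs_nonneg _) ((abs_nonneg _).trans h6)
    _ = A * (2 * C) ^ κ * C * ((t - s) ^ (α + α * κ - 1) * I) := by
        have : (t - s) ^ (α + α * κ - 1) = (t - s) ^ (α * κ - 1) * (t - s) ^ α := by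
          rw [← Real.rpow_add hl]; congr 1; ring
        rw [this]; ring
    _ ≤ A * (2 * C) ^ κ * C * (I ^ (α + α * κ - 1) * I) := by
        gcongr
    _ = A * (2 * C) ^ κ * C * I ^ (α + α * κ) := by
        have hIpos : 0 < I := hl.trans_le hlI
        rw [Real.rpow_sub_one hIpos.ne', div_mul_cancel₀ _ hIpos.ne']

theorem continuousOn_of_holder {X : ℝ → ℝ} {α C : ℝ} {S : Set ℝ} (hα : 0 < α)
    (hX : ∀ s ∈ S, ∀ t ∈ S, |X t - X s| ≤ C * |t - s| ^ α) : ContinuousOn X S := by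
  intro s hs
  rw [ContinuousWithinAt, tendsto_iff_dist_tendsto_zero]
  have hlim : Tendsto (fun t => C * |t - s| ^ α) (𝓝[S] s) (𝓝 0) := by
    have h1 : Tendsto (fun t : ℝ => |t - s|) (𝓝 s) (𝓝 0) := by
      have : ContinuousAt (fun t : ℝ => |t - s|) s := by fun_prop
      simpa [ContinuousAt] using this
    have h2 := (h1.rpow_const (p := α) (Or.inr hα.le)).const_mul C
    rw [Real.zero_rpow hα.ne', mul_zero] at h2
    exact h2.mono_left nhdsWithin_le_nhds
  refine squeeze_zero' (Eventually.of_forall fun _ => dist_nonneg) ?_ hlim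
  filter_upwards [self_mem_nhdsWithin] with t ht using hX s hs t ht

theorem exists_mem_Icc_of_ae {p : ℝ → Prop} (hp : ∀ᵐ r ∂(volume.restrict (Icc 0 T)), p r) {s t : ℝ}
    (hs : 0 ≤ s) (hst : s < t) (ht : t ≤ T) : ∃ x, p x ∧ x ∈ Icc s t := by
  have h1 := ae_restrict_of_ae_restrict_of_subset (Icc_subset_Icc hs ht) hp
  have : NeBot (ae (volume.restrict (Icc s t))) := by
    rw [ae_restrict_neBot]
    simpa using hst
  exact (h1.and (ae_restrict_mem measurableSet_Icc)).exists

end Path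

/-! ### Pathwise convergence and the main theorem. -/

/-- Pathwise convergence of the Riemann–Stieltjes integrals. -/
theorem exists_integrals_tendsto {X Y : ℝ → ℝ} {T α κ C M A : ℝ} {W : ℝ → ℝ≥0∞} {φ σ : ℝ → ℝ}
    {N : ℕ} {K : ℝ≥0} (hT : 0 < T) (hφ : Monotone φ) (hN : 1 ≤ N)
    (hint : ∀ n ≥ N, ∀ z : ℝ, Integrable fun y => gaussKernel (1 / (n : ℝ)) (z - y) * φ y)
    (hσ : LipschitzWith K σ)
    (hφosc : OscBound κ M A W φ) (hφnosc : ∀ n ≥ N, OscBound κ M A W (mollify φ n)) (hA : 0 ≤ A)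
    (hα : 0 < α) (hκ0 : 0 < κ) (hκ1 : κ < 1) (hθ : 1 < α + α * κ) (hC : 0 ≤ C)
    (hXM : ∀ t ∈ Icc 0 T, X t ∈ Ioo (-M) M)
    (hX : ∀ s ∈ Icc (0 : ℝ) T, ∀ t ∈ Icc (0 : ℝ) T, |X t - X s| ≤ C * |t - s| ^ α)
    (hY : ∀ s ∈ Icc (0 : ℝ) T, ∀ t ∈ Icc (0 : ℝ) T, |Y t - Y s| ≤ C * |t - s| ^ α)
    (hWm : Measurable W) (hWint : ∫⁻ t in Icc 0 T, W (X t) < ∞) :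
    ∃ (I : ℝ) (J : ℕ → ℝ), HasRSIntegral (fun s => φ (X s) * σ (X s)) Y 0 T I ∧
      (∀ n ≥ N, HasRSIntegral (fun s => mollify φ n (X s) * σ (X s)) Y 0 T (J n)) ∧
      Tendsto J atTop (𝓝 I) := by
  have hXc := continuousOn_of_holder hα hX
  have hM : 0 < M := by
    have := hXM 0 ⟨le_rfl, hT.le⟩
    linarith [this.1, this.2]
  have hWX : AEMeasurable (fun t => W (X t)) (volume.restrict (Icc 0 T)) :=
    hWm.comp_aemeasurable (hXc.aemeasurable measurableSet_Icc)
  have hfin : ∀ᵐ r ∂(volume.restrict (Icc 0 T)), W (X r) ≠ ∞ :=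
    (ae_lt_top' hWX hWint.ne).mono fun r hr => hr.ne
  have hw : IntegrableOn (fun r => 1 + (W (X r)).toReal) (Icc 0 T) :=
    (integrableOn_const (by simp)).add (integrable_toReal_of_lintegral_ne_top hWX hWint.ne)
  obtain ⟨K₁, hK₁, hK₁n⟩ := Monotone.exists_bound_mollify hφ hN hint M
  have hK₁0 : 0 ≤ K₁ := (abs_nonneg _).trans (hK₁ 0 ⟨by linarith, hM.le⟩)
  obtain ⟨K₂, hK₂⟩ := (isCompact_Icc (a := -M) (b := M)).exists_bound_of_continuousOn
    hσ.continuous.continuousOn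
  have hK₂0 : 0 ≤ K₂ := (norm_nonneg _).trans (hK₂ 0 ⟨by linarith, hM.le⟩)
  set A' := K₂ * A + K₁ * (K * (2 * M) ^ (1 - κ)) with hA'
  have hA'0 : 0 ≤ A' := by positivity
  have hXM' : ∀ t ∈ Icc 0 T, X t ∈ Icc (-M) M := fun t ht => Ioo_subset_Icc_self (hXM t ht)
  set F : ℝ → ℝ := fun t => (A' * (2 * C) ^ κ * C) ^ (α + α * κ)⁻¹
    * ∫ r in (0 : ℝ)..t, (1 + (W (X r)).toReal) with hF
  have hFm : MonotoneOn F (Icc 0 T) := by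
    intro s hs t ht hst
    have h1 := integral_sub_integral_of_mem hw hs ht
    have h2 := sub_le_integral hw
      (fun r => by linarith [ENNReal.toReal_nonneg (a := W (X r))]) hs.1 hst ht.2
    exact mul_le_mul_of_nonneg_left (by linarith) (Real.rpow_nonneg (by positivity) _)
  have hFc : ContinuousOn F (Icc 0 T) := by
    refine continuousOn_const.mul ?_
    have := intervalIntegral.continuousOn_primitive_interval (μ := volume) (a := 0) (b := T)
      (f := fun r => 1 + (W (X r)).toReal) (by rwa [uIcc_of_le hT.le])
    rwa [uIcc_of_le hT.le] at this
  have hc : RSControl (fun s => φ (X s) * σ (X s)) Y F (α + α * κ) 0 T :=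
    (hφosc.mul_lipschitz hκ1 hσ hK₁ hK₂).rsControl hA'0 hα hκ0 hθ hC hXM' hX hY hw hfin
  have hcn : ∀ n ≥ N, RSControl (fun s => mollify φ n (X s) * σ (X s)) Y F (α + α * κ) 0 T :=
    fun n hn => ((hφnosc n hn).mul_lipschitz hκ1 hσ (hK₁n n hn) hK₂).rsControl hA'0 hα hκ0 hθ hC
      hXM' hX hY hw hfin
  obtain ⟨I, hI⟩ := hc.exists_hasRSIntegral hθ hT hFm hFc
  have hJ : ∀ n, ∃ J, n ≥ N → HasRSIntegral (fun s => mollify φ n (X s) * σ (X s)) Y 0 T J := by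
    intro n
    by_cases hn : n ≥ N
    · obtain ⟨J, hJ⟩ := (hcn n hn).exists_hasRSIntegral hθ hT hFm hFc
      exact ⟨J, fun _ => hJ⟩
    · exact ⟨0, fun h => absurd h hn⟩
  choose J hJ using hJ
  refine ⟨I, J, hI, hJ, ?_⟩
  refine RSControl.tendsto_integral hθ hT hFm hFc
    (gs := fun n s => mollify φ n (X s) * σ (X s)) hcn hc
    (S := {r | W (X r) ≠ ∞ ∧ r ∈ Icc 0 T})
    (fun s t hs hst ht => ?_) (fun r hr => ?_) hJ hI
  · obtain ⟨x, hx1, hx2⟩ := exists_mem_Icc_of_ae hfin hs hst ht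
    exact ⟨x, ⟨hx1, hs.trans hx2.1, hx2.2.trans ht⟩, hx2⟩
  · exact (tendsto_mollify hφ (by omega) (hint N le_rfl)
      (hφosc.continuousAt hκ0 (hXM r hr.2) hr.1)).mul_const _

theorem monotone_rightDeriv {f : ℝ → ℝ} (hf : ConvexOn ℝ univ f) : Monotone (rightDeriv f) := by
  have := hf.monotoneOn_rightDeriv
  rw [interior_univ, monotoneOn_univ] at this
  exact this

end FractionalTanaka

theorem mainTheorem4 {Ω : Type*} [MeasurableSpace Ω] (P : Measure Ω) [IsProbabilityMeasure P]
    (H T : ℝ) (hH : H ∈ Ioo (1 / 2 : ℝ) 1) (hT : 0 < T)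
    (B X : ℝ → Ω → ℝ) (hB : FractionalTanaka.IsFractionalBrownianMotion P H T B)
    (b σ : ℝ → ℝ) (hb : Measurable b) (hσ : ∃ K : ℝ≥0, LipschitzWith K σ) (x₀ : ℝ)
    (hX : FractionalTanaka.IsSolution P T b σ x₀ B X)
    (hHolder : FractionalTanaka.HasHolderPathsBelow P H T X)
    (p : ℝ → ℝ → ℝ≥0∞) (hp : FractionalTanaka.HasIntegrableSupDensity P T X p)
    (f : ℝ → ℝ) (hf : ConvexOn ℝ univ f)
    (N : ℕ) (hN : 1 ≤ N)
    (hfN : ∀ n ≥ N, ∀ z : ℝ, Integrable (fun y : ℝ =>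
      FractionalTanaka.gaussKernel (1 / (n : ℝ)) (z - y) * FractionalTanaka.rightDeriv f y)) :
    ∀ᵐ ω ∂P, ∃ (I : ℝ) (J : ℕ → ℝ),
      FractionalTanaka.HasRSIntegral
        (fun s => FractionalTanaka.rightDeriv f (X s ω) * σ (X s ω)) (fun s => B s ω) 0 T I ∧
      (∀ n ≥ N, FractionalTanaka.HasRSIntegral
        (fun s => FractionalTanaka.mollifiedDeriv f n (X s ω) * σ (X s ω))
        (fun s => B s ω) 0 T (J n)) ∧
      Tendsto J atTop (𝓝 I) := by
  obtain ⟨K, hK⟩ := hσ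
  set α : ℝ := (1 / 2 + H) / 2 with hα
  have hα1 : 1 / 2 < α := by rw [hα]; linarith [hH.1]
  have hαH : α < H := by rw [hα]; linarith [hH.1]
  have hα0 : 0 < α := by linarith
  -- Chosen so that `α κ = 1/2`: then `θ = α + 1/2 > 1`, while `κ < 1`, both because `α > 1/2`.
  set κ : ℝ := 1 / (2 * α) with hκ
  have hκ0 : 0 < κ := by positivity
  have hκ1 : κ < 1 := by
    rw [hκ, div_lt_one (by positivity)]; linarith
  have hακ : α * κ = 1 / 2 := by rw [hκ]; field_simp
  have hφ := FractionalTanaka.monotone_rightDeriv hf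
  -- Integer radii `M` keep the exceptional sets countable in number; each path later selects an `M`
  -- exceeding its own maximum.
  have hex := fun M : ℕ => FractionalTanaka.Monotone.exists_oscBound (M := M) hφ hN hfN hκ0 hκ1
    (Nat.cast_nonneg M)
  choose ν hν A hA hosc hoscn using hex
  have hcont : ∀ᵐ ω ∂P, ContinuousOn (fun t => X t ω) (Icc 0 T) := by
    filter_upwards [hHolder] with ω hω
    obtain ⟨C, hC⟩ := hω α ⟨hα0, hαH⟩
    exact FractionalTanaka.continuousOn_of_holder hα0 hC
  have henergy : ∀ᵐ ω ∂P, ∀ M : ℕ,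
      ∫⁻ t in Icc 0 T, FractionalTanaka.rieszPotential κ (ν M) (X t ω) < ∞ :=
    ae_all_iff.2 fun M => by
      have := hν M
      exact hp.ae_lintegral_rieszPotential_lt_top hX.aemeasurable hcont hκ0 hκ1 (ν M)
  filter_upwards [hHolder, hB.ae_holder hT hα0 hαH, hcont, henergy] with ω hω hBω hc hE
  obtain ⟨C₁, hC₁⟩ := hω α ⟨hα0, hαH⟩
  obtain ⟨C₂, hC₂⟩ := hBω
  obtain ⟨R, hR⟩ := isCompact_Icc.exists_bound_of_continuousOn hc
  obtain ⟨M, hM⟩ := exists_nat_gt R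
  have := hν M
  have weaken : ∀ {Z : ℝ → ℝ} {C : ℝ}, C ≤ max (max C₁ C₂) 0 →
      (∀ s ∈ Icc (0 : ℝ) T, ∀ t ∈ Icc (0 : ℝ) T, |Z t - Z s| ≤ C * |t - s| ^ α) →
      ∀ s ∈ Icc (0 : ℝ) T, ∀ t ∈ Icc (0 : ℝ) T, |Z t - Z s| ≤ max (max C₁ C₂) 0 * |t - s| ^ α :=
    fun hle h s hs t ht => (h s hs t ht).trans
      (mul_le_mul_of_nonneg_right hle (Real.rpow_nonneg (abs_nonneg _) _))
  -- `mollifiedDeriv f n` is by definition `mollify (rightDeriv f) n`.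
  exact FractionalTanaka.exists_integrals_tendsto (X := fun t => X t ω) (Y := fun t => B t ω)
    hT hφ hN hfN hK (hosc M) (hoscn M) (hA M) hα0 hκ0 hκ1 (by linarith) (le_max_right _ _)
    (fun t ht => abs_lt.1 ((hR t ht).trans_lt hM))
    (weaken ((le_max_left _ _).trans (le_max_left _ _)) hC₁)
    (weaken ((le_max_right _ _).trans (le_max_left _ _)) hC₂)
    (FractionalTanaka.measurable_rieszPotential κ) (hE M)
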